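/- Let $K=\mathbb{Q}(\zeta)$ with $\zeta$ a primitive cube root of unity, and let $\mathfrak{p}=1-\zeta$. For a positive integer $n$ let $E_{16n^2}$ be the elliptic curve $y^2=x^3+16n^2$ and let $\phi:E_{16n^2}\to E_{16n^2}$ be the $3$-isogeny over $K$ given by $$\phi(x,y)=\Big(\frac{x^3+64n^2}{\mathfrak{p}^2x^2},\ \frac{y(x^3-128n^2)}{\mathfrak{p}^3x^3}\Big),$$ whose kernel is $E_{16n^2}[\phi]=\{O,(0,4n),(0,-4n)\}$. For a field $F$ write $(F^*/F^{*3}\times F^*/F^{*3})_{N=1}$ for the group of pairs $(\overline{x}_1,\overline{x}_2)$ with $\overline{x}_1\overline{x}_2=1$. For a finite prime $\mathfrak{q}$ of $K$, with completion $K_{\mathfrak{q}}$, the Kummer map $\delta_{\mathfrak{q}}:E_{16n^2}(K_{\mathfrak{q}})\to(K_{\mathfrak{q}}^*/K_{\mathfrak{q}}^{*3}\times K_{\mathfrak{q}}^*/K_{\mathfrak{q}}^{*3})_{N=1}$ attached to $\phi$ is the homomorphism with $O\mapsto(\overline{1},\overline{1})$, $(0,4n)\mapsto(\overline{n}^2,\overline{n})$,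 $(0,-4n)\mapsto(\overline{n},\overline{n}^2)$, and $P\mapsto(\overline{y(P)-4n},\overline{y(P)+4n})$ for $P\notin E_{16n^2}[\phi]$. The $\phi$-Selmer group $\mathrm{Sel}^\phi(E_{16n^2}/K)$ is the group of all $(\overline{x}_1,\overline{x}_2)\in(K^*/K^{*3}\times K^*/K^{*3})_{N=1}$ whose image in $K_{\mathfrak{q}}^*/K_{\mathfrak{q}}^{*3}\times K_{\mathfrak{q}}^*/K_{\mathfrak{q}}^{*3}$ lies in the image of $\delta_{\mathfrak{q}}$ for every finite prime $\mathfrak{q}$ of $K$; it is a vector space over $\mathbb{F}_3$. **Proposition.** Let $\ell_1\neq\ell_2$ be primes with $\ell_1\equiv\ell_2\equiv 2\pmod 3$, and let $n=\ell_1\ell_2$ or $n=\ell_1^2\ell_2^2$. Then $$\dim_{\mathbb{F}_3}\mathrm{Sel}^\phi(E_{16n^2}/K)=\begin{cases}1,&\text{if }\ell_1\equiv 2\pmod 9\text{ and }\ell_2\equiv 5\pmod 9,\\ 3,&\text{if }\ell_1\equiv\ell_2\equiv 8\pmod 9,\\ 2,&\text{if }n\equiv 4\text{ or }7\pmod 9.\end{cases}$$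 -/

import Mathlib

namespace CubeSum

/-! ### Cube classes -/

/-- The group `F* / F*³`. -/
def CubeClass (F : Type*) [Field F] : Type _ := Fˣ ⧸ (powMonoidHom 3 : Fˣ →* Fˣ).range

instance CubeClass.instCommGroup (F : Type*) [Field F] : CommGroup (CubeClass F) :=
  inferInstanceAs (CommGroup (Fˣ ⧸ (powMonoidHom 3 : Fˣ →* Fˣ).range))

/-- The quotient map `F* → F* / F*³`. -/
def CubeClass.mk {F : Type*} [Field F] : Fˣ →* CubeClass F :=
  QuotientGroup.mk' (powMonoidHom 3 : Fˣ →* Fˣ).range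

/-- The class `ā` of a nonzero `a : F` in `F* / F*³` (with the junk value `1` at `a = 0`). -/
noncomputable def cls {F : Type*} [Field F] (a : F) : CubeClass F :=
  open scoped Classical in if h : a = 0 then 1 else CubeClass.mk (Units.mk0 a h)

/-- The group `(F*/F*³ × F*/F*³)_{N=1}`, the kernel of `(x̄₁, x̄₂) ↦ x̄₁ x̄₂`. -/
def normOne (F : Type*) [Field F] : Subgroup (CubeClass F × CubeClass F) :=
  (mulMonoidHom : CubeClass F × CubeClass F →* CubeClass F).ker

/-- The map `K*/K*³ → F*/F*³` induced by a field extension `K → F`. -/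
def CubeClass.map (K F : Type*) [Field K] [Field F] [Algebra K F] : CubeClass K →* CubeClass F :=
  QuotientGroup.map _ _ (Units.map (algebraMap K F : K →* F)) (by
    rintro _ ⟨u, rfl⟩
    exact ⟨Units.map (algebraMap K F : K →* F) u, (map_pow _ u 3).symm⟩)

set_option linter.unusedSectionVars false

section cls

variable {F : Type*} [Field F]

lemma CubeClass.mk_eq_one_iff {u : Fˣ} : CubeClass.mk u = 1 ↔ ∃ w : Fˣ, w ^ 3 = u :=
  QuotientGroup.eq_one_iff (N := (powMonoidHom 3 : Fˣ →* Fˣ).range) u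

lemma CubeClass.mk_surjective : Function.Surjective (CubeClass.mk : Fˣ → CubeClass F) :=
  QuotientGroup.mk'_surjective _

lemma cls_of_ne {a : F} (h : a ≠ 0) : cls a = CubeClass.mk (Units.mk0 a h) := by
  simp [cls, h]

lemma cls_mul {a b : F} (ha : a ≠ 0) (hb : b ≠ 0) : cls (a * b) = cls a * cls b := by
  rw [cls_of_ne ha, cls_of_ne hb, cls_of_ne (mul_ne_zero ha hb), ← map_mul]
  congr 1
  ext
  simp

lemma cls_cube (a : F) : cls (a ^ 3) = 1 := by
  by_cases ha : a = 0
  · simp [cls, ha]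
  · rw [cls_of_ne (pow_ne_zero 3 ha), CubeClass.mk_eq_one_iff]
    exact ⟨Units.mk0 a ha, by ext; simp⟩

lemma CubeClass.pow_three (x : CubeClass F) : x ^ 3 = 1 := by
  obtain ⟨u, rfl⟩ := CubeClass.mk_surjective x
  rw [← map_pow, CubeClass.mk_eq_one_iff]
  exact ⟨u, rfl⟩

lemma cls_mul_eq_one {a b w : F} (hw : w ≠ 0) (h : a * b = w ^ 3) : cls a * cls b = 1 := by
  have h0 : a * b ≠ 0 := h ▸ pow_ne_zero 3 hw
  rw [← cls_mul (left_ne_zero_of_mul h0) (right_ne_zero_of_mul h0), h, cls_cube]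

lemma cls_mul_mul_eq_one {a b c w : F} (hw : w ≠ 0) (h : a * b * c = w ^ 3) :
    cls a * cls b * cls c = 1 := by
  have h0 : a * b * c ≠ 0 := h ▸ pow_ne_zero 3 hw
  rw [← cls_mul (left_ne_zero_of_mul (left_ne_zero_of_mul h0))
    (right_ne_zero_of_mul (left_ne_zero_of_mul h0)), ← cls_mul (left_ne_zero_of_mul h0)
    (right_ne_zero_of_mul h0), h, cls_cube]

end cls

/-! ### The curve and the isogeny -/

/-- The elliptic curve `E_{16n²} : y² = x³ + 16n²` over `F`. -/
def curve (n : ℕ) (F : Type*) [Field F] : WeierstrassCurve.Affine F :=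
  ⟨0, 0, 0, 0, 16 * (n : F) ^ 2⟩

section curve

variable {n : ℕ} {F : Type*} [Field F]

lemma curve_equation_iff {x y : F} :
    (curve n F).Equation x y ↔ y ^ 2 = x ^ 3 + 16 * (n : F) ^ 2 := by
  simp [WeierstrassCurve.Affine.equation_iff, curve]

variable [CharZero F] [NeZero n]

lemma natCast_ne (n : ℕ) (F : Type*) [Field F] [CharZero F] [NeZero n] : (n : F) ≠ 0 :=
  Nat.cast_ne_zero.mpr (NeZero.ne n)

lemma curve_nonsingular_iff {x y : F} :
    (curve n F).Nonsingular x y ↔ y ^ 2 = x ^ 3 + 16 * (n : F) ^ 2 := by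
  rw [← WeierstrassCurve.Affine.equation_iff_nonsingular_of_Δ_ne_zero, curve_equation_iff]
  have hn := natCast_ne n F
  simp [curve, WeierstrassCurve.Δ, WeierstrassCurve.b₂, WeierstrassCurve.b₄,
    WeierstrassCurve.b₆, WeierstrassCurve.b₈, hn]

lemma one_sub_pow_six {ζ : F} (hζ : IsPrimitiveRoot ζ 3) : (1 - ζ) ^ 6 = -27 := by
  have h1 : ζ ^ 2 + ζ + 1 = 0 := by
    have := hζ.geom_sum_eq_zero (by norm_num)
    simp only [Finset.sum_range_succ, Finset.sum_range_zero] at this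
    linear_combination this
  linear_combination (ζ ^ 4 - 7 * ζ ^ 3 + 21 * ζ ^ 2 - 34 * ζ + 28) * h1

lemma phi_nonsingular {ζ : F} (hζ : IsPrimitiveRoot ζ 3) {x y : F}
    (h : (curve n F).Nonsingular x y) (hx : x ≠ 0) :
    (curve n F).Nonsingular ((x ^ 3 + 64 * (n : F) ^ 2) / ((1 - ζ) ^ 2 * x ^ 2))
      (y * (x ^ 3 - 128 * (n : F) ^ 2) / ((1 - ζ) ^ 3 * x ^ 3)) := by
  rw [curve_nonsingular_iff] at h ⊢
  have h6 := one_sub_pow_six hζ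
  have hp : 1 - ζ ≠ 0 := by
    intro h0
    rw [h0] at h6
    norm_num at h6
  generalize 1 - ζ = p at h6 hp
  have e1 : (y * (x ^ 3 - 128 * (n : F) ^ 2) / (p ^ 3 * x ^ 3)) ^ 2 =
      y ^ 2 * (x ^ 3 - 128 * (n : F) ^ 2) ^ 2 / (-27 * x ^ 6) := by
    rw [← h6]; field_simp
  have e2 : ((x ^ 3 + 64 * (n : F) ^ 2) / (p ^ 2 * x ^ 2)) ^ 3 =
      (x ^ 3 + 64 * (n : F) ^ 2) ^ 3 / (-27 * x ^ 6) := by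
    rw [← h6]; field_simp
  rw [e1, e2, h]
  field_simp
  ring

/-- The 3-isogeny `φ : E_{16n²} → E_{16n²}` on `F`-points, for a field `F` containing the primitive
cube root of unity `ζ`; with `𝔭 = 1 - ζ` it is
`(x, y) ↦ ((x³ + 64n²) / (𝔭²x²), y(x³ - 128n²) / (𝔭³x³))`,
where the point at infinity and the points with `x = 0` (the poles of these rational functions)
are sent to the point at infinity. -/
noncomputable def phi (n : ℕ) [NeZero n] {F : Type*} [Field F] [CharZero F] {ζ : F}
    (hζ : IsPrimitiveRoot ζ 3) : (curve n F).Point → (curve n F).Point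
  | .zero => .zero
  | .some x y h =>
    open scoped Classical in
    if hx : x = 0 then .zero
    else .some ((x ^ 3 + 64 * (n : F) ^ 2) / ((1 - ζ) ^ 2 * x ^ 2))
      (y * (x ^ 3 - 128 * (n : F) ^ 2) / ((1 - ζ) ^ 3 * x ^ 3)) (phi_nonsingular hζ h hx)

lemma phi_some_eq_zero_iff {ζ : F} (hζ : IsPrimitiveRoot ζ 3) {x y : F}
    (h : (curve n F).Nonsingular x y) : phi n hζ (.some x y h) = 0 ↔ x = 0 := by
  by_cases hx : x = 0
  · simp [phi, hx, WeierstrassCurve.Affine.Point.zero_def]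
  · simp [phi, hx]

end curve

/-! ### The Kummer map -/

/-- The Kummer map `δ : E_{16n²}(F) → F*/F*³ × F*/F*³` attached to `φ`:
`O ↦ (1, 1)`, `(0, 4n) ↦ (n̄², n̄)`, `(0, -4n) ↦ (n̄, n̄²)` and `P ↦ (y(P) - 4n, y(P) + 4n)` for
`P ∉ E_{16n²}[φ]`. (The points of `E_{16n²}[φ]` other than `O` are exactly `(0, ±4n)`.) -/
noncomputable def kummerMap (n : ℕ) [NeZero n] {F : Type*} [Field F] [CharZero F] {ζ : F}
    (hζ : IsPrimitiveRoot ζ 3) : (curve n F).Point → CubeClass F × CubeClass F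
  | .zero => (1, 1)
  | .some x y h =>
    open scoped Classical in
    if phi n hζ (.some x y h) = 0 then
      if y = 4 * n then (cls (n : F) ^ 2, cls (n : F)) else (cls (n : F), cls (n : F) ^ 2)
    else (cls (y - 4 * n), cls (y + 4 * n))

section kummer

variable {n : ℕ} {F : Type*} [Field F] [CharZero F] [NeZero n]

/-- The second component of the Kummer map at `(x, y)`, written uniformly with `c = 4n`. -/
noncomputable def second (c y : F) : CubeClass F :=
  open scoped Classical in if y = -c then cls ((2 * c) ^ 2) else cls (y + c)

lemma second_pos {c y : F} (h : y = -c) : second c y = cls ((2 * c) ^ 2) := if_pos h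

lemma second_neg {c y : F} (h : y ≠ -c) : second c y = cls (y + c) := if_neg h

lemma cls_eight_mul {a : F} (ha : a ≠ 0) : cls (8 * a) = cls a := by
  rw [cls_mul (by norm_num) ha, show (8 : F) = 2 ^ 3 by norm_num, cls_cube, one_mul]

lemma second_mul_second_neg {c x y : F} (hc : c ≠ 0) (h : y ^ 2 = x ^ 3 + c ^ 2) :
    second c y * second c (-y) = 1 := by
  have h2 : 2 * c ≠ 0 := mul_ne_zero two_ne_zero hc
  have hcc : c ≠ -c := fun hh => h2 (by linear_combination hh)
  by_cases h1 : y = -c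
  · subst h1
    rw [second_pos rfl, neg_neg, second_neg hcc]
    exact cls_mul_eq_one h2 (by ring)
  by_cases h3 : y = c
  · subst h3
    rw [second_neg h1, second_pos rfl]
    exact cls_mul_eq_one h2 (by ring)
  have h4 : -y ≠ -c := fun hh => h3 (neg_injective hh)
  rw [second_neg h1, second_neg h4]
  refine cls_mul_eq_one (w := -x) ?_ (by linear_combination -h)
  intro hx
  have : (y + c) * (y - c) = 0 := by
    have hx' : x = 0 := neg_eq_zero.mp hx
    rw [hx'] at h
    linear_combination h
  rcases mul_eq_zero.mp this with h5 | h5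
  · exact h1 (by linear_combination h5)
  · exact h3 (by linear_combination h5)

lemma second_line_aux {c l x₁ x₂ x₃ : F} (hc : c ≠ 0) (hl : l ≠ 0) (h1 : x₁ = 0)
    (e2 : x₁ * x₂ + x₁ * x₃ + x₂ * x₃ = 2 * l * c) :
    second c (l * x₁ - c) * second c (l * x₂ - c) * second c (l * x₃ - c) = 1 := by
  subst h1
  have h2 : 2 * c ≠ 0 := mul_ne_zero two_ne_zero hc
  have h23 : x₂ * x₃ = 2 * l * c := by linear_combination e2
  have h0 : x₂ * x₃ ≠ 0 := by rw [h23]; exact mul_ne_zero (mul_ne_zero two_ne_zero hl) hc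
  have k2 : l * x₂ - c ≠ -c := fun hh =>
    mul_ne_zero hl (left_ne_zero_of_mul h0) (by linear_combination hh)
  have k3 : l * x₃ - c ≠ -c := fun hh =>
    mul_ne_zero hl (right_ne_zero_of_mul h0) (by linear_combination hh)
  rw [second_pos (by ring), second_neg k2, second_neg k3]
  refine cls_mul_mul_eq_one (w := 2 * c * l) (mul_ne_zero h2 hl) ?_
  linear_combination 4 * c ^ 2 * l ^ 2 * h23

/-- The product over the three intersection points of the curve with a line is trivial. -/
lemma second_line {c l m x₁ x₂ x₃ : F} (hc : c ≠ 0) (e1 : x₁ + x₂ + x₃ = l ^ 2)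
    (e2 : x₁ * x₂ + x₁ * x₃ + x₂ * x₃ = -2 * l * m) (e3 : x₁ * x₂ * x₃ = m ^ 2 - c ^ 2) :
    second c (l * x₁ + m) * second c (l * x₂ + m) * second c (l * x₃ + m) = 1 := by
  have hprod : (l * x₁ + m + c) * (l * x₂ + m + c) * (l * x₃ + m + c) = (m + c) ^ 3 := by
    linear_combination l ^ 3 * e3 + l ^ 2 * (m + c) * e2 + l * (m + c) ^ 2 * e1
  by_cases hm : m + c = 0
  · obtain rfl : m = -c := by linear_combination hm
    simp only [← sub_eq_add_neg]
    by_cases hl : l = 0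
    · subst hl
      rw [second_pos (by ring), second_pos (by ring), second_pos (by ring)]
      exact cls_mul_mul_eq_one (w := (2 * c) ^ 2)
        (pow_ne_zero 2 (mul_ne_zero two_ne_zero hc)) (by ring)
    have hz : x₁ * x₂ * x₃ = 0 := by rw [e3]; ring
    rcases mul_eq_zero.mp hz with h | h
    · rcases mul_eq_zero.mp h with h | h
      · exact second_line_aux hc hl h (by linear_combination e2)
      · rw [mul_comm (second c (l * x₁ - c))]
        exact second_line_aux hc hl h (by linear_combination e2)
    · rw [mul_comm (_ * _) (second c (l * x₃ - c)), ← mul_assoc]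
      exact second_line_aux hc hl h (by linear_combination e2)
  · have h0 := pow_ne_zero 3 hm
    rw [← hprod] at h0
    rw [second_neg, second_neg, second_neg]
    · exact cls_mul_mul_eq_one hm hprod
    · exact fun hh => right_ne_zero_of_mul h0 (by linear_combination hh)
    · exact fun hh => right_ne_zero_of_mul (left_ne_zero_of_mul h0) (by linear_combination hh)
    · exact fun hh => left_ne_zero_of_mul (left_ne_zero_of_mul h0) (by linear_combination hh)

lemma curve_c {x y : F} (h : (curve n F).Nonsingular x y) :
    y ^ 2 = x ^ 3 + (4 * (n : F)) ^ 2 := by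
  rw [curve_nonsingular_iff.mp h]; ring

lemma kummerMap_zero {ζ : F} (hζ : IsPrimitiveRoot ζ 3) : kummerMap n hζ 0 = (1, 1) := rfl

/-- The Kummer map has values in the pairs of norm one, and its second component is `second`. -/
lemma kummerMap_some {ζ : F} (hζ : IsPrimitiveRoot ζ 3) {x y : F}
    (h : (curve n F).Nonsingular x y) :
    kummerMap n hζ (.some x y h) = ((second (4 * (n : F)) y)⁻¹, second (4 * (n : F)) y) := by
  have hn := natCast_ne n F
  have h4 : 4 * (n : F) ≠ 0 := mul_ne_zero (by norm_num) hn
  have h8 : 4 * (n : F) ≠ -(4 * (n : F)) := fun hh =>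
    mul_ne_zero two_ne_zero h4 (by linear_combination hh)
  have hc := curve_c h
  have cube : cls (n : F) ^ 3 = 1 := CubeClass.pow_three _
  have c8 : cls (4 * (n : F) + 4 * n) = cls (n : F) := by
    rw [show 4 * (n : F) + 4 * n = 8 * n by ring, cls_eight_mul hn]
  simp only [kummerMap]
  split_ifs with h1 h2
  · have h2' : second (4 * (n : F)) y = cls (n : F) := by
      rw [h2, second_neg h8, c8]
    rw [h2']
    exact Prod.ext (eq_inv_of_mul_eq_one_left (by rw [← pow_succ, cube])) rfl
  · rw [phi_some_eq_zero_iff] at h1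
    have hy : y = -(4 * (n : F)) := by
      have : (y - 4 * n) * (y + 4 * n) = 0 := by rw [h1] at hc; linear_combination hc
      rcases mul_eq_zero.mp this with h5 | h5
      · exact absurd (by linear_combination h5) h2
      · linear_combination h5
    have h2' : second (4 * (n : F)) y = cls (n : F) ^ 2 := by
      rw [second_pos hy, show (2 * (4 * (n : F))) ^ 2 = (8 * n) * (8 * n) by ring,
        cls_mul (by simpa using hn) (by simpa using hn), cls_eight_mul hn, sq]
    rw [h2']
    exact Prod.ext (eq_inv_of_mul_eq_one_left (by rw [← pow_succ', cube])) rfl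
  · rw [phi_some_eq_zero_iff] at h1
    have hp : (y - 4 * n) * (y + 4 * n) = x ^ 3 := by linear_combination hc
    have hy : y ≠ -(4 * (n : F)) := by
      rintro rfl
      exact pow_ne_zero 3 h1 (by linear_combination -hp)
    rw [second_neg hy]
    exact Prod.ext (eq_inv_of_mul_eq_one_left (cls_mul_eq_one h1 hp)) rfl

lemma kummerMap_neg {ζ : F} (hζ : IsPrimitiveRoot ζ 3) (P : (curve n F).Point) :
    kummerMap n hζ (-P) = (kummerMap n hζ P)⁻¹ := by
  rcases P with _ | ⟨x, y, h⟩
  · exact (inv_one).symm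
  · have h4 : 4 * (n : F) ≠ 0 := mul_ne_zero (by norm_num) (natCast_ne n F)
    rw [WeierstrassCurve.Affine.Point.neg_some, kummerMap_some, kummerMap_some]
    have e : (curve n F).negY x y = -y := by simp [curve, WeierstrassCurve.Affine.negY]
    rw [e, eq_inv_of_mul_eq_one_right (second_mul_second_neg h4 (curve_c h))]
    rfl

lemma kummerMap_add [DecidableEq F] {ζ : F} (hζ : IsPrimitiveRoot ζ 3)
    (P Q : (curve n F).Point) :
    kummerMap n hζ (P + Q) = kummerMap n hζ P * kummerMap n hζ Q := by
  rcases P with _ | ⟨x₁, y₁, h₁⟩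
  · rw [← WeierstrassCurve.Affine.Point.zero_def, zero_add]
    exact (one_mul _).symm
  rcases Q with _ | ⟨x₂, y₂, h₂⟩
  · rw [← WeierstrassCurve.Affine.Point.zero_def, add_zero]
    exact (mul_one _).symm
  by_cases hxy : x₁ = x₂ ∧ y₁ = (curve n F).negY x₂ y₂
  · have hP : WeierstrassCurve.Affine.Point.some x₁ y₁ h₁ = -.some x₂ y₂ h₂ := by
      rw [WeierstrassCurve.Affine.Point.neg_some]
      congr 1
      · exact hxy.1
      · exact hxy.2
    rw [hP, neg_add_cancel, kummerMap_neg, inv_mul_cancel]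
    rfl
  · have h4 : 4 * (n : F) ≠ 0 := mul_ne_zero (by norm_num) (natCast_ne n F)
    obtain ⟨l, hl⟩ : ∃ l, l = (curve n F).slope x₁ x₂ y₁ y₂ := ⟨_, rfl⟩
    obtain ⟨x₃, hx₃⟩ : ∃ x₃, x₃ = (curve n F).addX x₁ x₂ l := ⟨_, rfl⟩
    obtain ⟨m, hm⟩ : ∃ m, m = y₁ - l * x₁ := ⟨_, rfl⟩
    have hy₁ : y₁ = l * x₁ + m := by rw [hm]; ring
    have hy₂ : y₂ = l * x₂ + m := by
      by_cases hx : x₁ = x₂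
      · have hy : y₁ ≠ (curve n F).negY x₂ y₂ := fun h => hxy ⟨hx, h⟩
        have := WeierstrassCurve.Affine.Y_eq_of_Y_ne h₁.left h₂.left hx hy
        rw [← this, ← hx, hy₁]
      · have h12 := sub_ne_zero_of_ne hx
        have : l * (x₁ - x₂) = y₁ - y₂ := by
          rw [hl, WeierstrassCurve.Affine.slope_of_X_ne hx, div_mul_cancel₀ _ h12]
        rw [hm]; linear_combination this
    have hpoly := WeierstrassCurve.Affine.addPolynomial_slope h₁.left h₂.left hxy
    rw [← hl, ← hx₃, WeierstrassCurve.Affine.addPolynomial_eq] at hpoly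
    have hev : ∀ t : F, (l * t + m) ^ 2 - t ^ 3 - (4 * (n : F)) ^ 2 =
        -((t - x₁) * (t - x₂) * (t - x₃)) := by
      intro t
      have := congrArg (Polynomial.eval t) hpoly
      simp [Cubic.toPoly, curve] at this
      rw [hm]
      linear_combination this
    have e1 : x₁ + x₂ + x₃ = l ^ 2 := by
      rw [hx₃]; simp [WeierstrassCurve.Affine.addX, curve]
    have e3 : x₁ * x₂ * x₃ = m ^ 2 - (4 * (n : F)) ^ 2 := by linear_combination -hev 0
    have e2 : x₁ * x₂ + x₁ * x₃ + x₂ * x₃ = -2 * l * m := by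
      linear_combination hev 1 - hev 0 + e1
    have key := second_line h4 e1 e2 e3
    have hneg : (curve n F).addY x₁ x₂ y₁ l = -(l * x₃ + m) := by
      rw [WeierstrassCurve.Affine.addY, WeierstrassCurve.Affine.negAddY, ← hx₃, hm]
      simp [WeierstrassCurve.Affine.negY, curve]
      ring
    have hns := WeierstrassCurve.Affine.nonsingular_add h₁ h₂ hxy
    have h3 := curve_c hns
    rw [← hl, hneg] at h3
    have key2 := second_mul_second_neg h4 h3
    rw [neg_neg] at key2
    rw [WeierstrassCurve.Affine.Point.add_some hxy, kummerMap_some, kummerMap_some, kummerMap_some,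
      ← hl, hneg, hy₁, hy₂]
    have hs : second (4 * (n : F)) (-(l * x₃ + m)) =
        second (4 * (n : F)) (l * x₁ + m) * second (4 * (n : F)) (l * x₂ + m) := by
      rw [eq_inv_of_mul_eq_one_left key2, eq_inv_of_mul_eq_one_left key]
    rw [hs, mul_inv]
    rfl

end kummer

/-- The image of the Kummer map, a subgroup because the Kummer map is a homomorphism. -/
noncomputable def kummerImage (n : ℕ) [NeZero n] {F : Type*} [Field F] [CharZero F] {ζ : F}
    (hζ : IsPrimitiveRoot ζ 3) : Subgroup (CubeClass F × CubeClass F) where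
  carrier := Set.range (kummerMap n hζ)
  mul_mem' := by
    classical
    rintro _ _ ⟨P, rfl⟩ ⟨Q, rfl⟩
    exact ⟨P + Q, kummerMap_add hζ P Q⟩
  one_mem' := ⟨0, rfl⟩
  inv_mem' := by
    rintro _ ⟨P, rfl⟩
    exact ⟨-P, kummerMap_neg hζ P⟩

/-! ### The Selmer group -/

open IsDedekindDomain in
/-- The completion of a number field at a finite prime has characteristic zero. -/
instance (K : Type*) [Field K] [NumberField K]
    (v : HeightOneSpectrum (NumberField.RingOfIntegers K)) : CharZero (v.adicCompletion K) :=
  charZero_of_injective_algebraMap (algebraMap K (v.adicCompletion K)).injective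

open IsDedekindDomain in
/-- The `φ`-Selmer group `Sel^φ(E_{16n²}/K)`: the pairs `(x̄₁, x̄₂) ∈ (K*/K*³ × K*/K*³)_{N=1}`
whose image in `K_𝔮*/K_𝔮*³ × K_𝔮*/K_𝔮*³` lies in the image of the Kummer map of
`E_{16n²}(K_𝔮)`, for every finite prime `𝔮` of `K`. -/
noncomputable def selmer (n : ℕ) [NeZero n] {K : Type*} [Field K] [NumberField K] {ζ : K}
    (hζ : IsPrimitiveRoot ζ 3) : Subgroup (CubeClass K × CubeClass K) :=
  normOne K ⊓ ⨅ v : HeightOneSpectrum (NumberField.RingOfIntegers K),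
    (kummerImage n (hζ.map_of_injective (algebraMap K (v.adicCompletion K)).injective)).comap
      ((CubeClass.map K (v.adicCompletion K)).prodMap (CubeClass.map K (v.adicCompletion K)))

/-- The `𝔽₃`-vector space structure on a subgroup of `F*/F*³ × F*/F*³`, written additively. -/
noncomputable instance {F : Type*} [Field F] (S : Subgroup (CubeClass F × CubeClass F)) :
    Module (ZMod 3) (Additive S) :=
  AddCommGroup.zmodModule fun x => by
    apply Additive.toMul.injective
    apply Subtype.ext
    exact Prod.ext (CubeClass.pow_three _) (CubeClass.pow_three _)

end CubeSum

/-! A pair of norm one is determined by its second component `u`, so everything takes place in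
`K*/K*³`. By `pair_mem_kummerImage_iff`, the class `u` is in a local image iff the plane cubic `uX³
+ u²Y³ + nZ³ = 0` has a point over the completion. The Selmer group thus consists of the `u` whose
cubic is everywhere locally soluble, and both forms of `n` are handled together as `n = (l₁l₂)^e`
with `e` prime to `3`.

Where `n` is a unit, solubility forces the valuation of `u` to be divisible by `3`. Since `ℤ[ζ]` is
a PID with units `±ζ^i`, and the `lᵢ` are inert, `u = ζ^a l₁^b l₂^c` up to cubes
(`exists_eq_of_mem_selmer`); these three generators are independent (`dvd_exponents_of_cls_eq_one`).
It remains to decide which exponents survive.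

Away from `3n` every unit class is allowed: a diagonal cubic over the residue field has a zero,
which lifts by Hensel's lemma. At `lᵢ`, the valuation of `n` is prime to `3`, so the local image
contains the class of `n` but no nontrivial unit class (`cls_eq_one_of_mem`). Rational integers
prime to `lᵢ` are cubes there, whereas `ζ` is a cube iff `9 ∣ lᵢ² - 1`, that is `lᵢ ≡ 8 mod 9`.
Hence `3 ∣ a` unless both primes are `8` mod `9`.

Above `3`, integers congruent to `±1` mod `9` are cubes and the class of `n` is allowed. If both
primes are `8` mod `9`, then `l₁`, `l₂` are locally trivial and `ζ` is allowed because `ζ + ζ² + 1 =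
0`: dimension `3`. If `n ≡ 4, 7`, then `n` generates `(ℤ/9)ˣ/±1`, so `l₁` and `l₂` are both allowed:
dimension `2`. If the primes are `2` and `5` mod `9`, then `l₁^b l₂^c` has the local class of
`2^(b-c)`, and `2` is excluded (`two_not_mem_kummerImage`), leaving the powers of `n`: dimension
`1`. -/

namespace CubeSum

open IsDedekindDomain NumberField

set_option linter.unusedSectionVars false

/-! ### Diagonal cubics over finite fields -/

/-- In a finite field, three classes distinct modulo cubes exhaust the unit group. -/
lemma exists_cube_mul_of_distinct {F : Type*} [Field F] [Finite F] {a b c : Fˣ}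
    (hab : ¬ ∃ w : Fˣ, a = b * w ^ 3) (hac : ¬ ∃ w : Fˣ, a = c * w ^ 3)
    (hbc : ¬ ∃ w : Fˣ, b = c * w ^ 3) (s : Fˣ) :
    (∃ w : Fˣ, s = a * w ^ 3) ∨ (∃ w : Fˣ, s = b * w ^ 3) ∨ (∃ w : Fˣ, s = c * w ^ 3) := by
  have hq : ∀ {x y : Fˣ}, (CubeClass.mk y = CubeClass.mk x) ↔ ∃ w : Fˣ, y = x * w ^ 3 := by
    intro x y
    rw [eq_comm, ← inv_mul_eq_one, ← map_inv, ← map_mul, CubeClass.mk_eq_one_iff]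
    exact exists_congr fun w => by rw [eq_inv_mul_iff_mul_eq, eq_comm]
  rw [← hq] at hab hac hbc
  rw [← hq, ← hq, ← hq]
  -- A cyclic group of exponent dividing `3` has at most three elements, so `s`, `a`, `b`, `c`
  -- cannot have four distinct classes.
  have hcyc : IsCyclic (CubeClass F) := isCyclic_of_surjective _ CubeClass.mk_surjective
  have : Finite (CubeClass F) := Finite.of_surjective _ (CubeClass.mk_surjective (F := F))
  have hcard : Nat.card (CubeClass F) ≤ 3 := by
    rw [← IsCyclic.exponent_eq_card]
    exact Nat.le_of_dvd (by norm_num) (Monoid.exponent_dvd_of_forall_pow_eq_one CubeClass.pow_three)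
  by_contra! h
  obtain ⟨h1, h2, h3⟩ := h
  have := Fintype.ofFinite (CubeClass F)
  classical
  have h4 : ({CubeClass.mk s, CubeClass.mk a, CubeClass.mk b, CubeClass.mk c} :
      Finset (CubeClass F)).card = 4 := by
    rw [Finset.card_insert_of_notMem, Finset.card_insert_of_notMem, Finset.card_insert_of_notMem,
      Finset.card_singleton] <;> simp_all
  have h5 := Finset.card_le_univ ({CubeClass.mk s, CubeClass.mk a, CubeClass.mk b, CubeClass.mk c} :
      Finset (CubeClass F))
  rw [h4, ← Nat.card_eq_fintype_card] at h5
  omega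

/-- A diagonal ternary cubic form over a finite field has a nontrivial zero. -/
lemma exists_diagonal_cubic_zero {F : Type*} [Field F] [Finite F] {a b c : F} (ha : a ≠ 0)
    (hb : b ≠ 0) (hc : c ≠ 0) :
    ∃ x y z : F, (x ≠ 0 ∨ y ≠ 0 ∨ z ≠ 0) ∧ a * x ^ 3 + b * y ^ 3 + c * z ^ 3 = 0 := by
  lift a to Fˣ using ha.isUnit
  lift b to Fˣ using hb.isUnit
  lift c to Fˣ using hc.isUnit
  by_contra! H
  have hab : ¬ ∃ w : Fˣ, a = b * w ^ 3 := by
    rintro ⟨w, hw⟩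
    exact H 1 (-w) 0 (by simp) (by rw [hw]; push_cast; ring)
  have hac : ¬ ∃ w : Fˣ, a = c * w ^ 3 := by
    rintro ⟨w, hw⟩
    exact H 1 0 (-w) (by simp) (by rw [hw]; push_cast; ring)
  have hbc : ¬ ∃ w : Fˣ, b = c * w ^ 3 := by
    rintro ⟨w, hw⟩
    exact H 0 1 (-w) (by simp) (by rw [hw]; push_cast; ring)
  let C : Type _ := {h : Fˣ // ∃ w : Fˣ, h = w ^ 3}
  -- For a nonzero cube `h`, the sum `a + bh` is nonzero and lies in the cube class of `a`, `b` or
  -- `c`. The class of `c` would give a zero of the form; the other two attach to `h` a nonzero cube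
  -- `k`. The resulting self-map of the finite set of nonzero cubes is injective but misses `-1`,
  -- which is the contradiction.
  have key : ∀ h : C, ∃ k : C, ((a : F) * (k.1 + 1) = -(b * h.1)) ∨
      ((b : F) * h.1 * (k.1 + 1) = -a) := by
    rintro ⟨h, w, rfl⟩
    have h0 : (a + b * w ^ 3 : F) ≠ 0 := by
      simpa using H 1 w 0 (by simp)
    rcases exists_cube_mul_of_distinct hab hac hbc (Units.mk0 _ h0) with ⟨t, ht⟩ | ⟨t, ht⟩ | ⟨t, ht⟩
    · have ht' := congrArg Units.val ht
      refine ⟨⟨-t ^ 3, -t, by rw [Odd.neg_pow (by decide)]⟩, Or.inl ?_⟩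
      push_cast at ht' ⊢
      simp only [Units.val_mk0] at ht'
      linear_combination ht'
    · have ht' := congrArg Units.val ht
      refine ⟨⟨-(t / w) ^ 3, -(t / w), by rw [Odd.neg_pow (by decide)]⟩, Or.inr ?_⟩
      push_cast at ht' ⊢
      simp only [Units.val_mk0] at ht'
      have := w.ne_zero
      field_simp
      linear_combination ht'
    · have ht' := congrArg Units.val ht
      push_cast at ht'
      simp only [Units.val_mk0] at ht'
      exact absurd (by linear_combination ht') (H 1 w (-t) (by simp))
  choose f hf using key
  -- A common value arising from the two different alternatives would make `a²/b²` a cube, hence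
  -- also `a/b`.
  have hmix : ∀ x y : C, ((a : F) * ((f x).1 + 1) = -(b * x.1)) →
      ((b : F) * y.1 * ((f y).1 + 1) = -a) → f x ≠ f y := by
    rintro ⟨x, u, rfl⟩ ⟨y, v, rfl⟩ h1 h2 h
    rw [h] at h1
    have e : (a : F) ^ 2 = b ^ 2 * (u * v) ^ 3 := by
      push_cast at h1 h2
      linear_combination a * h2 - b * v ^ 3 * h1
    refine hab ⟨a / (b * (u * v)), Units.ext ?_⟩
    have := b.ne_zero
    have := u.ne_zero
    have := v.ne_zero
    push_cast
    field_simp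
    linear_combination -e
  have hinj : Function.Injective f := by
    intro x y h
    rcases hf x with h1 | h1 <;> rcases hf y with h2 | h2
    · rw [h] at h1
      exact Subtype.ext (Units.ext (mul_left_cancel₀ b.ne_zero (by linear_combination h1 - h2)))
    · exact absurd h (hmix x y h1 h2)
    · exact absurd h.symm (hmix y x h2 h1)
    · rw [h] at h1
      have h3 : ((f y).1 + 1 : F) ≠ 0 := fun h0 => a.ne_zero (by rw [h0] at h2; linear_combination h2)
      exact Subtype.ext (Units.ext (mul_left_cancel₀ (mul_ne_zero h3 b.ne_zero)
        (by linear_combination h1 - h2)))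
  obtain ⟨x, hx⟩ := Finite.surjective_of_injective hinj ⟨-1, -1, by rw [Odd.neg_pow (by decide)]; simp⟩
  have hx' : ((f x).1 + 1 : F) = 0 := by rw [hx]; simp
  rcases hf x with h1 | h1 <;> rw [hx'] at h1
  · exact mul_ne_zero b.ne_zero x.1.ne_zero (by linear_combination h1)
  · exact a.ne_zero (by linear_combination h1)

/-! ### Hensel's lemma for cube roots -/

/-- Hensel's lemma for cube roots near `1` in a complete ultrametric field. -/
lemma exists_cube_root_of_norm_lt {F : Type*} [NormedField F] [IsUltrametricDist F]
    [CompleteSpace F] {x : F} (hx : ‖x - 1‖ < ‖(9 : F)‖) : ∃ y, y ^ 3 = x := by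
  have h90 : (0 : ℝ) < ‖(9 : F)‖ := (norm_nonneg _).trans_lt hx
  have h3ne : (3 : F) ≠ 0 := by
    intro h
    rw [show (9 : F) = 3 * 3 by norm_num, h] at h90
    simp at h90
  have h3 : (0 : ℝ) < ‖(3 : F)‖ := norm_pos_iff.mpr h3ne
  have h31 : ‖(3 : F)‖ ≤ 1 := by
    simpa using IsUltrametricDist.norm_natCast_le_one F 3
  obtain ⟨r, hr⟩ : ∃ r, r = ‖x - 1‖ / ‖(3 : F)‖ := ⟨_, rfl⟩
  have hr3 : r < ‖(3 : F)‖ := by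
    rw [hr, div_lt_iff₀ h3, ← norm_mul]
    norm_num
    exact hx
  have hr0 : 0 ≤ r := by rw [hr]; positivity
  have hr1 : r < 1 := hr3.trans_le h31
  -- Newton's iteration for `w³ = x`, with the derivative `3w²` frozen at its value at `w = 1`. The
  -- hypothesis on `x` says exactly that `r < ‖3‖`, which is what the cubic error term `d³` needs in
  -- order to contract.
  let g : F → F := fun w => w - (w ^ 3 - x) / 3
  let w : ℕ → F := fun k => g^[k] 1
  have hw : ∀ k, w (k + 1) = w k - (w k ^ 3 - x) / 3 := fun k => Function.iterate_succ_apply' g k 1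
  have inv : ∀ k, ‖w k - 1‖ ≤ r ∧ ‖w k ^ 3 - x‖ ≤ ‖(3 : F)‖ * r * r ^ k := by
    intro k
    induction k with
    | zero =>
      refine ⟨by simp [w, hr0], ?_⟩
      simp only [w, Function.iterate_zero, id, one_pow, pow_zero, mul_one]
      rw [hr, mul_div_cancel₀ _ h3.ne', norm_sub_rev]
    | succ k ih =>
      obtain ⟨ih1, ih2⟩ := ih
      obtain ⟨d, hd⟩ : ∃ d, d = (w k ^ 3 - x) / 3 := ⟨_, rfl⟩
      have hd3 : w k ^ 3 - x = 3 * d := by rw [hd]; field_simp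
      have hdn : ‖d‖ ≤ r * r ^ k := by
        rw [hd3, norm_mul, mul_assoc] at ih2
        exact le_of_mul_le_mul_left ih2 h3
      have hdr : ‖d‖ ≤ r := hdn.trans (mul_le_of_le_one_right hr0 (pow_le_one₀ hr0 hr1.le))
      have hw1 : ‖w k‖ ≤ 1 := by
        have := IsUltrametricDist.norm_add_le_max (w k - 1) 1
        rw [sub_add_cancel, norm_one] at this
        exact this.trans (max_le (ih1.trans hr1.le) le_rfl)
      have hwp : ‖w k + 1‖ ≤ 1 := by
        have := IsUltrametricDist.norm_add_le_max (w k) 1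
        rw [norm_one] at this
        exact this.trans (max_le hw1 le_rfl)
      rw [hw, ← hd]
      constructor
      · have := IsUltrametricDist.norm_add_le_max (w k - 1) (-d)
        rw [show w k - d - 1 = w k - 1 + -d by ring]
        exact this.trans (max_le ih1 (by rwa [norm_neg]))
      · have e : (w k - d) ^ 3 - x =
            3 * d * -((w k - 1) * (w k + 1)) + (3 * d * (w k * d) + -(d * d * d)) := by
          linear_combination hd3
        have hb : ‖(3 : F)‖ * r * r ^ (k + 1) = (‖(3 : F)‖ * (r * r ^ k)) * r := by ring
        rw [e, hb]
        refine (IsUltrametricDist.norm_add_le_max _ _).trans (max_le ?_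
          ((IsUltrametricDist.norm_add_le_max _ _).trans (max_le ?_ ?_)))
        · rw [norm_mul, norm_mul, norm_neg, norm_mul]
          gcongr
          exact (mul_le_of_le_one_right (norm_nonneg _) hwp).trans ih1
        · rw [norm_mul, norm_mul, norm_mul]
          gcongr
          exact (mul_le_of_le_one_left (norm_nonneg _) hw1).trans hdr
        · rw [norm_neg, norm_mul, norm_mul]
          gcongr
          exact hdr.trans hr3.le
  have hc : CauchySeq w := by
    refine cauchySeq_of_le_geometric r r hr1 fun k => ?_
    rw [hw, dist_eq_norm, sub_sub_cancel, norm_div, div_le_iff₀ h3]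
    exact (inv k).2.trans (by rw [mul_assoc, mul_comm])
  obtain ⟨y, hy⟩ := cauchySeq_tendsto_of_complete hc
  refine ⟨y, sub_eq_zero.mp (norm_eq_zero.mp (le_antisymm ?_ (norm_nonneg _)))⟩
  have t1 : Filter.Tendsto (fun k => ‖w k ^ 3 - x‖) Filter.atTop (nhds ‖y ^ 3 - x‖) :=
    ((hy.pow 3).sub_const x).norm
  have t2 : Filter.Tendsto (fun k => ‖(3 : F)‖ * r * r ^ k) Filter.atTop (nhds (‖(3 : F)‖ * r * 0)) :=
    (tendsto_pow_atTop_nhds_zero_of_lt_one hr0 hr1).const_mul _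
  rw [mul_zero] at t2
  exact le_of_tendsto_of_tendsto' t1 t2 fun k => (inv k).2

/-! ### Pairs of norm one as an `𝔽₃`-vector space -/

/-- The pair of norm one with the given second component. -/
def pair {F : Type*} [Field F] : CubeClass F →* CubeClass F × CubeClass F :=
  MonoidHom.prod invMonoidHom (MonoidHom.id _)

lemma pair_apply {F : Type*} [Field F] (x : CubeClass F) : pair x = (x⁻¹, x) := rfl

lemma mem_normOne_iff {F : Type*} [Field F] {x : CubeClass F × CubeClass F} :
    x ∈ normOne F ↔ x = pair x.2 := by
  rw [normOne, MonoidHom.mem_ker, pair_apply, Prod.ext_iff]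
  simp [mulMonoidHom, eq_inv_iff_mul_eq_one]

lemma pow_mod_three {F : Type*} [Field F] (x : CubeClass F) (m : ℕ) : x ^ (m % 3) = x ^ m := by
  conv_rhs => rw [← Nat.div_add_mod m 3, pow_add, pow_mul, CubeClass.pow_three, one_pow, one_mul]

/-- The dimension of a subgroup of pairs of norm one with an explicit basis. -/
lemma finrank_eq_of_basis {F : Type*} [Field F] {S : Subgroup (CubeClass F × CubeClass F)} {d : ℕ}
    (g : Fin d → CubeClass F) (hg : ∀ i, pair (g i) ∈ S)
    (hspan : ∀ x ∈ S, ∃ e : Fin d → ℕ, x = pair (∏ i, g i ^ e i))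
    (hind : ∀ e : Fin d → ℕ, ∏ i, g i ^ e i = 1 → ∀ i, 3 ∣ e i) :
    Module.finrank (ZMod 3) (Additive S) = d := by
  let b : Fin d → Additive S := fun i => Additive.ofMul ⟨pair (g i), hg i⟩
  have hsm : ∀ (c : ZMod 3) (x : Additive S), c • x = c.val • x := by
    intro c x
    conv_lhs => rw [← ZMod.natCast_zmod_val c]
    rw [Nat.cast_smul_eq_nsmul]
  have hval : ∀ e : Fin d → ℕ, ((∑ i, e i • b i).toMul : CubeClass F × CubeClass F) =
      pair (∏ i, g i ^ e i) := by
    intro e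
    rw [toMul_sum, Subgroup.val_finsetProd, map_prod]
    refine Finset.prod_congr rfl fun i _ => ?_
    rw [map_pow]
    rfl
  have hli : LinearIndependent (ZMod 3) b := by
    rw [Fintype.linearIndependent_iff]
    intro c hc i
    simp only [hsm] at hc
    have h1 := hval fun i => (c i).val
    rw [hc] at h1
    have h2 := congrArg Prod.snd h1
    have h3 := hind (fun i => (c i).val) h2.symm i
    exact (ZMod.val_eq_zero _).mp (Nat.eq_zero_of_dvd_of_lt h3 (ZMod.val_lt _))
  have hsp : ⊤ ≤ Submodule.span (ZMod 3) (Set.range b) := by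
    intro x _
    obtain ⟨e, he⟩ := hspan _ x.toMul.2
    have : x = ∑ i, e i • b i := by
      apply Additive.toMul.injective
      apply Subtype.ext
      rw [hval, he]
    rw [this]
    exact Submodule.sum_mem _ fun i _ =>
      nsmul_mem (Submodule.subset_span (Set.mem_range_self i)) _
  simpa using Module.finrank_eq_card_basis (Module.Basis.mk hli hsp)

/-! ### The Kummer image as solubility of a plane cubic -/

/-- The class `u` lies in the image of the Kummer map iff the cubic `uX³ + u²Y³ + nZ³ = 0` has a
nontrivial solution. -/
lemma pair_mem_kummerImage_iff {n : ℕ} [NeZero n] {F : Type*} [Field F] [CharZero F] {ζ : F}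
    (hζ : IsPrimitiveRoot ζ 3) {u : F} (hu : u ≠ 0) :
    pair (cls u) ∈ kummerImage n hζ ↔
      ∃ X Y Z : F, (X ≠ 0 ∨ Y ≠ 0 ∨ Z ≠ 0) ∧ u * X ^ 3 + u ^ 2 * Y ^ 3 + n * Z ^ 3 = 0 := by
  have hn := natCast_ne n F
  have h4 : 4 * (n : F) ≠ 0 := mul_ne_zero (by norm_num) hn
  have hcls : ∀ {a : F}, a ≠ 0 → cls a = cls u → ∃ w, a = u * w ^ 3 := by
    intro a ha h
    rw [cls_of_ne ha, cls_of_ne hu, eq_comm, ← inv_mul_eq_one, ← map_inv, ← map_mul,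
      CubeClass.mk_eq_one_iff] at h
    obtain ⟨w, hw⟩ := h
    refine ⟨w, ?_⟩
    have := congrArg Units.val hw
    push_cast at this
    simp only [Units.val_mk0] at this
    rw [this]
    field_simp
  constructor
  · rintro ⟨P, hP⟩
    rcases P with _ | ⟨x, y, h⟩
    · have h1 : (1 : CubeClass F) = cls u := congrArg Prod.snd hP
      obtain ⟨w, hw⟩ := hcls (a := 1) one_ne_zero (by rw [← h1, ← one_pow 3, cls_cube])
      have hw0 : w ≠ 0 := by rintro rfl; simp at hw
      exact ⟨1, -w, 0, by simp, by linear_combination u * hw⟩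
    · rw [kummerMap_some] at hP
      have h1 : second (4 * (n : F)) y = cls u := congrArg Prod.snd hP
      have hc := curve_c h
      by_cases hy : y = -(4 * (n : F))
      · rw [second_pos hy] at h1
        obtain ⟨w, hw⟩ := hcls (pow_ne_zero 2 (mul_ne_zero two_ne_zero h4)) h1
        have hw0 : w ≠ 0 := by
          rintro rfl
          exact pow_ne_zero 2 (mul_ne_zero two_ne_zero h4) (by rw [hw]; ring)
        -- Here `(8n)² = uw³`, so `u²w⁶ = (8n)⁴ = n(16n)³`.
        refine ⟨0, w ^ 2, -(16 * n), by simp [hw0], ?_⟩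
        linear_combination -(u * w ^ 3 + (2 * (4 * (n : F))) ^ 2) * hw
      · rw [second_neg hy] at h1
        have hy0 : y + 4 * n ≠ 0 := fun hh => hy (by linear_combination hh)
        obtain ⟨w, hw⟩ := hcls hy0 h1
        have hw0 : w ≠ 0 := by rintro rfl; exact hy0 (by rw [hw]; ring)
        -- From `y + 4n = uw³` and `(y - 4n)(y + 4n) = x³`; subtracting the two factors gives `uw³ -
        -- x³/(uw³) = 8n`, which is the cubic.
        refine ⟨w, -x / (w * u), -2, by simp [hw0], ?_⟩
        have e : (y - 4 * n) * (u * w ^ 3) = x ^ 3 := by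
          rw [← hw]; linear_combination hc
        field_simp
        linear_combination e - u * w ^ 3 * hw
  · rintro ⟨X, Y, Z, h0, h⟩
    -- Points with `Z = 0` make `u` a cube, the image of `O`; those with `X = 0` come from `(0,
    -- -4n)`; any other comes from the point with `y + 4n = u(-2X/Z)³`.
    by_cases hZ : Z = 0
    · subst hZ
      have hY : Y ≠ 0 := by
        rintro rfl
        have : X = 0 := by
          have : u * X ^ 3 = 0 := by linear_combination h
          simpa [hu] using this
        simp [this] at h0
      have : u = (-X / Y) ^ 3 := by
        have : u * (u * Y ^ 3 + X ^ 3) = 0 := by linear_combination h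
        have := (mul_eq_zero.mp this).resolve_left hu
        field_simp
        linear_combination this
      rw [this, cls_cube, map_one]
      exact one_mem _
    · by_cases hX : X = 0
      · subst hX
        refine ⟨.some 0 (-(4 * n)) (curve_nonsingular_iff.mpr (by ring)), ?_⟩
        rw [kummerMap_some, second_pos rfl, pair_apply]
        have hY : Y ≠ 0 := by
          rintro rfl
          have : (n : F) * Z ^ 3 = 0 := by linear_combination h
          simp [hn, hZ] at this
        have e : (2 * (4 * (n : F))) ^ 2 = u * (4 * u * Y ^ 2 / Z ^ 2) ^ 3 := by
          field_simp
          linear_combination 4 * (n * Z ^ 3 - u ^ 2 * Y ^ 3) * h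
        rw [e, cls_mul hu (pow_ne_zero 3 (by simp [hu, hY, hZ])), cls_cube, mul_one]
      · have hu2 : u * (-2 * X / Z) ^ 3 ≠ 0 := by
          refine mul_ne_zero hu (pow_ne_zero 3 (div_ne_zero (mul_ne_zero (by norm_num) hX) hZ))
        have hmem : (curve n F).Nonsingular (-(4 * u * X * Y / Z ^ 2)) (u * (-2 * X / Z) ^ 3 - 4 * n) := by
          rw [curve_nonsingular_iff]
          field_simp
          linear_combination 64 * u * X ^ 3 * h
        refine ⟨.some _ _ hmem, ?_⟩
        rw [kummerMap_some, second_neg, pair_apply, sub_add_cancel, cls_mul hu, cls_cube, mul_one]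
        · exact right_ne_zero_of_mul hu2
        · intro hh
          exact hu2 (by linear_combination hh)

/-! ### Valuations of the terms of the cubic -/

section Valuation

variable {F Γ : Type*} [Field F] [LinearOrderedCommGroupWithZero Γ] (w : Valuation F Γ)

/-- If three elements sum to zero, the two largest valuations agree. -/
lemma valuation_of_sum_eq_zero {a b c : F} (h : a + b + c = 0) (h0 : a ≠ 0 ∨ b ≠ 0 ∨ c ≠ 0) :
    (w a = w b ∧ a ≠ 0 ∧ b ≠ 0 ∧ w c ≤ w a) ∨ (w a = w c ∧ a ≠ 0 ∧ c ≠ 0) ∨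
      (w b = w c ∧ b ≠ 0 ∧ c ≠ 0) := by
  have hc : w c = w (a + b) := by
    rw [← Valuation.map_neg]; congr 1; linear_combination -h
  have ne : ∀ {x y : F}, w x = w y → x ≠ 0 → y ≠ 0 := by
    rintro x y h hx rfl
    rw [map_zero, map_eq_zero] at h
    exact hx h
  rcases lt_trichotomy (w a) (w b) with hlt | heq | hlt
  · rw [Valuation.map_add_eq_of_lt_right w hlt] at hc
    have hb : b ≠ 0 := by rintro rfl; simp at hlt
    exact .inr (.inr ⟨hc.symm, hb, ne hc.symm hb⟩)
  · have ha : a ≠ 0 := by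
      rintro rfl
      rw [map_zero, eq_comm, map_eq_zero] at heq
      subst heq
      simp_all
    refine .inl ⟨heq, ha, ne heq ha, ?_⟩
    rw [hc]
    exact (w.map_add a b).trans (by rw [heq, max_self])
  · rw [Valuation.map_add_eq_of_lt_left w hlt] at hc
    have ha : a ≠ 0 := by rintro rfl; simp at hlt
    exact .inr (.inl ⟨hc.symm, ha, ne hc.symm ha⟩)

/-- The valuation of `x` is that of a nonzero cube. -/
def HasCubeValuation (x : F) : Prop := ∃ z : F, z ≠ 0 ∧ w x = w z ^ 3

variable {w}

lemma HasCubeValuation.mul {x y : F} (hx : HasCubeValuation w x) (hy : HasCubeValuation w y) :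
    HasCubeValuation w (x * y) := by
  obtain ⟨a, ha, hxa⟩ := hx
  obtain ⟨b, hb, hyb⟩ := hy
  exact ⟨a * b, mul_ne_zero ha hb, by rw [map_mul, hxa, hyb, map_mul, mul_pow]⟩

lemma HasCubeValuation.inv {x : F} (hx : HasCubeValuation w x) : HasCubeValuation w x⁻¹ := by
  obtain ⟨a, ha, hxa⟩ := hx
  exact ⟨a⁻¹, inv_ne_zero ha, by rw [map_inv₀, hxa, map_inv₀, inv_pow]⟩

lemma hasCubeValuation_of_eq_one {x : F} (hx : w x = 1) : HasCubeValuation w x :=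
  ⟨1, one_ne_zero, by simp [hx]⟩

lemma hasCubeValuation_cube {x : F} (hx : x ≠ 0) : HasCubeValuation w (x ^ 3) :=
  ⟨x, hx, map_pow w x 3⟩

lemma hasCubeValuation_mul_cube_iff {x y : F} (hy : y ≠ 0) :
    HasCubeValuation w (x * y ^ 3) ↔ HasCubeValuation w x := by
  refine ⟨fun h => ?_, fun h => h.mul (hasCubeValuation_cube hy)⟩
  have := h.mul (hasCubeValuation_cube hy).inv
  rwa [mul_inv_cancel_right₀ (pow_ne_zero 3 hy)] at this

lemma HasCubeValuation.congr {x y : F} (h : w x = w y) (hx : HasCubeValuation w x) :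
    HasCubeValuation w y := by
  obtain ⟨z, hz, e⟩ := hx
  exact ⟨z, hz, h ▸ e⟩

lemma HasCubeValuation.of_sq {x : F} (hx0 : x ≠ 0) (hx : HasCubeValuation w (x ^ 2)) :
    HasCubeValuation w x := by
  have := (hasCubeValuation_cube (w := w) hx0).mul hx.inv
  rwa [show x ^ 3 * (x ^ 2)⁻¹ = x by field_simp] at this

/-- Two of the three terms have equal valuation. Modulo cubes of values the terms are `u`, `u²` and
`1`, and any coincidence among these makes the value of `u` a cube. The residue characteristic plays
no role, so this also covers the prime above `3`. -/
lemma HasCubeValuation.of_solution {u n X Y Z : F} (hu : u ≠ 0) (hn : w n = 1)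
    (h0 : X ≠ 0 ∨ Y ≠ 0 ∨ Z ≠ 0) (h : u * X ^ 3 + u ^ 2 * Y ^ 3 + n * Z ^ 3 = 0) :
    HasCubeValuation w u := by
  have hn0 : n ≠ 0 := by rintro rfl; simp at hn
  have hn' : HasCubeValuation w n := hasCubeValuation_of_eq_one hn
  have hcube : ∀ {c X : F}, c * X ^ 3 ≠ 0 → X ≠ 0 := fun h hX => h (by rw [hX]; ring)
  rcases valuation_of_sum_eq_zero w h (by simpa [hu, hn0] using h0) with
    ⟨e, hx, hy, -⟩ | ⟨e, hx, hz⟩ | ⟨e, hy, hz⟩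
  · have : w (X ^ 3) = w (u * Y ^ 3) := by
      rw [map_mul, show u ^ 2 * Y ^ 3 = u * (u * Y ^ 3) by ring, map_mul w u] at e
      exact mul_left_cancel₀ (by simpa using hu) e
    exact (hasCubeValuation_mul_cube_iff (hcube hy)).mp
      ((hasCubeValuation_cube (hcube hx)).congr this)
  · exact (hasCubeValuation_mul_cube_iff (hcube hx)).mp
      ((hn'.mul (hasCubeValuation_cube (hcube hz))).congr e.symm)
  · exact .of_sq hu <| (hasCubeValuation_mul_cube_iff (hcube hy)).mp
      ((hn'.mul (hasCubeValuation_cube (hcube hz))).congr e.symm)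

/-- The term `nZ³` cannot tie with either of the others, since that would make the value of `n` a
cube. So `uX³` and `u²Y³` have equal valuation and strictly dominate; dividing by `uX³` shows
`u(-Y/X)³` is near `1`. -/
lemma exists_cube_near_of_solution {u n X Y Z : F} (hu : u ≠ 0) (hn0 : n ≠ 0)
    (hu' : HasCubeValuation w u) (hn : ¬ HasCubeValuation w n)
    (h0 : X ≠ 0 ∨ Y ≠ 0 ∨ Z ≠ 0) (h : u * X ^ 3 + u ^ 2 * Y ^ 3 + n * Z ^ 3 = 0) :
    ∃ t : F, t ≠ 0 ∧ w (u * t ^ 3 - 1) < 1 := by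
  have hcube : ∀ {c X : F}, c * X ^ 3 ≠ 0 → X ≠ 0 := fun h hX => h (by rw [hX]; ring)
  have e1 : w (u * X ^ 3) = w (n * Z ^ 3) → u * X ^ 3 ≠ 0 → n * Z ^ 3 ≠ 0 → False := fun e hx hz =>
    hn ((hasCubeValuation_mul_cube_iff (hcube hz)).mp
      ((hu'.mul (hasCubeValuation_cube (hcube hx))).congr e))
  rcases valuation_of_sum_eq_zero w h (by simpa [hu, hn0] using h0) with
    ⟨e, hx, hy, hle⟩ | ⟨e, hx, hz⟩ | ⟨e, hy, hz⟩
  · have hX := hcube hx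
    have hlt : w (n * Z ^ 3) < w (u * X ^ 3) := by
      refine lt_of_le_of_ne hle fun e' => e1 e'.symm hx ?_
      intro hz
      rw [hz, map_zero, eq_comm, map_eq_zero] at e'
      exact hx e'
    refine ⟨-Y / X, div_ne_zero (neg_ne_zero.mpr (hcube hy)) hX, ?_⟩
    have : u * (-Y / X) ^ 3 - 1 = n * Z ^ 3 / (u * X ^ 3) := by
      field_simp
      linear_combination -h
    rw [this, map_div₀]
    exact (div_lt_one₀ (zero_lt_iff.mpr ((map_ne_zero w).mpr hx))).mpr hlt
  · exact (e1 e hx hz).elim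
  · refine (hn ((hasCubeValuation_mul_cube_iff (hcube hz)).mp
      (((hu'.mul hu').mul (hasCubeValuation_cube (hcube hy))).congr ?_))).elim
    rw [← e]; ring_nf

end Valuation

/-! ### Approximation and cube roots in the completions -/

section Completion

variable {K : Type*} [Field K] [NumberField K] (v : HeightOneSpectrum (𝓞 K))

/-- Hensel's lemma for cube roots near `1` in the completion at a finite prime. -/
lemma exists_cube_root {x : v.adicCompletion K}
    (hx : Valued.v (x - 1) < Valued.v (9 : v.adicCompletion K)) : ∃ y, y ^ 3 = x := by
  have : IsUltrametricDist (v.adicCompletion K) := inferInstance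
  refine exists_cube_root_of_norm_lt ?_
  exact Valued.toNormedField.norm_lt_iff.mpr hx

lemma valued_coe_eq (x : K) :
    Valued.v (algebraMap K (v.adicCompletion K) x) = v.valuation K x :=
  HeightOneSpectrum.valuedAdicCompletion_eq_valuation' v x

lemma exists_integer_near {x z : v.adicCompletion K} (hx : Valued.v x ≤ 1) (hz : z ≠ 0) :
    ∃ a : 𝓞 K, Valued.v (x - algebraMap K (v.adicCompletion K) a) < Valued.v z := by
  -- Keeping the radius at most `1` makes the approximant `k` from `K` integral at `v`, so that it
  -- can in turn be approximated by an element of `𝓞 K`.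
  obtain ⟨z', hz', hz1, hz2⟩ : ∃ z' : v.adicCompletion K, z' ≠ 0 ∧ Valued.v z' ≤ Valued.v z ∧
      Valued.v z' ≤ 1 := by
    rcases le_total (Valued.v z) 1 with h | h
    · exact ⟨z, hz, le_rfl, h⟩
    · exact ⟨1, one_ne_zero, by simpa using h, by simp⟩
  obtain ⟨k, hk⟩ := (Metric.denseRange_iff.mp (v.denseRange_algebraMap K)) x ‖z'‖ (norm_pos_iff.mpr hz')
  rw [dist_eq_norm, Valued.toNormedField.norm_lt_iff] at hk
  have hk1 : v.valuation K k ≤ 1 := by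
    rw [← valued_coe_eq]
    have := Valuation.map_sub Valued.v x (x - algebraMap K (v.adicCompletion K) k)
    rw [sub_sub_cancel] at this
    exact this.trans (max_le hx (hk.le.trans hz2))
  have hu : (Valued.v z' : WithZero (Multiplicative ℤ)) ≠ 0 := (map_ne_zero _).mpr hz'
  obtain ⟨a, ha⟩ := v.exists_valuation_sub_lt_of_integer hk1 (Units.mk0 _ hu)
  refine ⟨a, lt_of_lt_of_le ?_ hz1⟩
  rw [← valued_coe_eq, map_sub] at ha
  have := Valuation.map_sub Valued.v (x - algebraMap K (v.adicCompletion K) k)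
    (algebraMap K (v.adicCompletion K) (algebraMap (𝓞 K) K a) - algebraMap K (v.adicCompletion K) k)
  rw [sub_sub_sub_cancel_right] at this
  exact this.trans_lt (max_lt hk ha)

end Completion

/-! ### Local images at primes of good reduction -/

section LocalMap

variable {K : Type*} [Field K] [NumberField K] (v : HeightOneSpectrum (𝓞 K))

/-- The embedding of the integers of `K` in the completion at a finite prime. -/
noncomputable def localMap : 𝓞 K →+* v.adicCompletion K :=
  (algebraMap K (v.adicCompletion K)).comp (algebraMap (𝓞 K) K)

variable {v}

lemma localMap_lt_one_iff {a : 𝓞 K} : Valued.v (localMap v a) < 1 ↔ a ∈ v.asIdeal := by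
  rw [localMap, RingHom.comp_apply, valued_coe_eq, HeightOneSpectrum.valuation_lt_one_iff_mem]

lemma localMap_eq_one_iff {a : 𝓞 K} : Valued.v (localMap v a) = 1 ↔ a ∉ v.asIdeal := by
  rw [localMap, RingHom.comp_apply, valued_coe_eq, HeightOneSpectrum.valuation_eq_one_iff_notMem]

lemma localMap_le_one (a : 𝓞 K) : Valued.v (localMap v a) ≤ 1 := by
  rw [localMap, RingHom.comp_apply, valued_coe_eq]
  exact v.valuation_le_one a

lemma exists_localMap_near {x z : v.adicCompletion K} (hx : Valued.v x ≤ 1) (hz : z ≠ 0) :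
    ∃ a : 𝓞 K, Valued.v (x - localMap v a) < Valued.v z :=
  exists_integer_near v hx hz

lemma natCast_lt_one_iff {m : ℕ} : Valued.v (m : v.adicCompletion K) < 1 ↔ (m : 𝓞 K) ∈ v.asIdeal := by
  rw [← map_natCast (localMap v), localMap_lt_one_iff]

lemma natCast_eq_one_iff {m : ℕ} : Valued.v (m : v.adicCompletion K) = 1 ↔ (m : 𝓞 K) ∉ v.asIdeal := by
  rw [← map_natCast (localMap v), localMap_eq_one_iff]

lemma natCast_not_mem_of_coprime {a b : ℕ} (h : a.Coprime b) (ha : (a : 𝓞 K) ∈ v.asIdeal) :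
    (b : 𝓞 K) ∉ v.asIdeal := by
  intro hb
  have h1 : ((a : ℤ) * a.gcdA b + b * a.gcdB b : ℤ) = 1 := by
    rw [← Nat.gcd_eq_gcd_ab, h]; rfl
  have h2 : ((a : 𝓞 K) * (a.gcdA b : ℤ) + b * (a.gcdB b : ℤ) : 𝓞 K) = 1 := by exact_mod_cast h1
  refine v.isPrime.ne_top ((Ideal.eq_top_iff_one _).mpr ?_)
  rw [← h2]
  exact Ideal.add_mem _ (Ideal.mul_mem_right _ _ ha) (Ideal.mul_mem_right _ _ hb)

/-- Away from `3`, a unit near `1` is a cube. -/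
lemma exists_cube_root_of_lt_one (h3 : (3 : 𝓞 K) ∉ v.asIdeal) {x : v.adicCompletion K}
    (hx : Valued.v (x - 1) < 1) : ∃ y, y ^ 3 = x := by
  refine exists_cube_root v (hx.trans_eq ?_)
  have : Valued.v (3 : v.adicCompletion K) = 1 := by
    have := (natCast_eq_one_iff (v := v) (m := 3)).mpr (by simpa using h3)
    simpa using this
  rw [show (9 : v.adicCompletion K) = 3 * 3 by norm_num, map_mul, this, mul_one]

/-- The quotient `-b/a` is near `1`, hence a cube. This turns an approximate zero of the cubic into
an exact one by rescaling a single coordinate. -/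
lemma exists_mul_cube_add_eq_zero (h3 : (3 : 𝓞 K) ∉ v.asIdeal) {a b : v.adicCompletion K}
    (ha : Valued.v a = 1) (hab : Valued.v (a + b) < 1) : ∃ t, t ≠ 0 ∧ a * t ^ 3 + b = 0 := by
  have ha0 : a ≠ 0 := by rintro rfl; simp at ha
  obtain ⟨t, ht⟩ := exists_cube_root_of_lt_one h3 (x := -b / a) (by
    rw [show -b / a - 1 = -(a + b) / a by field_simp; ring, map_div₀, ha, div_one, Valuation.map_neg]
    exact hab)
  refine ⟨t, ?_, by rw [ht]; field_simp; ring⟩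
  rintro rfl
  have hb : b = 0 := by
    field_simp at ht
    simpa using ht.symm
  rw [hb, add_zero, ha] at hab
  exact lt_irrefl _ hab

lemma finite_residue (v : HeightOneSpectrum (𝓞 K)) : Finite (𝓞 K ⧸ v.asIdeal) :=
  v.asIdeal.finiteQuotientOfFreeOfNeBot v.ne_bot

/-- At a prime of good reduction all unit classes are in the image of the Kummer map. -/
lemma pair_mem_kummerImage_of_unit {n : ℕ} [NeZero n] {ξ : v.adicCompletion K}
    (hξ : IsPrimitiveRoot ξ 3) (h3 : (3 : 𝓞 K) ∉ v.asIdeal) (hn : (n : 𝓞 K) ∉ v.asIdeal)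
    {u : v.adicCompletion K} (hu : Valued.v u = 1) : pair (cls u) ∈ kummerImage n hξ := by
  have hu0 : u ≠ 0 := by rintro rfl; simp at hu
  rw [pair_mem_kummerImage_iff hξ hu0]
  -- A global integer `a` near `u` allows the cubic to be reduced in `𝓞 K ⧸ v.asIdeal`; `hsum`
  -- transfers the resulting congruence back from `a` to `u`.
  obtain ⟨a, ha⟩ := exists_localMap_near hu.le one_ne_zero
  rw [map_one] at ha
  have ha1 : Valued.v (localMap v a) = 1 := by
    have := Valuation.map_sub_eq_of_lt_right Valued.v (ha.trans_eq hu.symm)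
    rw [← hu, ← this, ← Valuation.map_neg]
    congr 1; ring
  have ham := localMap_eq_one_iff.mp ha1
  have := finite_residue v
  let : Field (𝓞 K ⧸ v.asIdeal) := Ideal.Quotient.field _
  let π := Ideal.Quotient.mk v.asIdeal
  have hπ : ∀ {x : 𝓞 K}, π x = 0 ↔ x ∈ v.asIdeal := Ideal.Quotient.eq_zero_iff_mem
  obtain ⟨x, y, z, h0, h⟩ := exists_diagonal_cubic_zero (a := π a) (b := π (a ^ 2)) (c := π n)
    (by rwa [ne_eq, hπ]) (by rw [map_pow]; exact pow_ne_zero 2 (by rwa [ne_eq, hπ]))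
    (by rwa [ne_eq, hπ])
  obtain ⟨x, rfl⟩ := Ideal.Quotient.mk_surjective x
  obtain ⟨y, rfl⟩ := Ideal.Quotient.mk_surjective y
  obtain ⟨z, rfl⟩ := Ideal.Quotient.mk_surjective z
  change π a * π x ^ 3 + π (a ^ 2) * π y ^ 3 + π n * π z ^ 3 = 0 at h
  change π x ≠ 0 ∨ π y ≠ 0 ∨ π z ≠ 0 at h0
  simp only [← map_pow, ← map_mul, ← map_add, hπ] at h
  simp only [ne_eq, hπ] at h0
  rw [← localMap_lt_one_iff] at h
  simp only [← localMap_eq_one_iff] at h0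
  set X := localMap v x with hX
  set Y := localMap v y with hY
  set Z := localMap v z with hZ
  simp only [map_add, map_mul, map_pow, map_natCast, ← hX, ← hY, ← hZ] at h
  have hX1 : Valued.v X ≤ 1 := localMap_le_one x
  have hY1 : Valued.v Y ≤ 1 := localMap_le_one y
  have hsum : Valued.v (u * X ^ 3 + u ^ 2 * Y ^ 3 + n * Z ^ 3) < 1 := by
    have e : u * X ^ 3 + u ^ 2 * Y ^ 3 + n * Z ^ 3 =
        (localMap v a * X ^ 3 + localMap v a ^ 2 * Y ^ 3 + n * Z ^ 3) +
          (u - localMap v a) * (X ^ 3 + (u + localMap v a) * Y ^ 3) := by ring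
    rw [e]
    refine Valuation.map_add_lt _ h ?_
    rw [map_mul]
    refine mul_lt_one_of_lt_of_le ha ?_
    refine Valuation.map_add_le _ (by rw [map_pow]; exact pow_le_one' hX1 3) ?_
    rw [map_mul, map_pow]
    exact mul_le_one' (Valuation.map_add_le _ hu.le ha1.le) (pow_le_one' hY1 3)
  have hn1 : Valued.v (n : v.adicCompletion K) = 1 := natCast_eq_one_iff.mpr hn
  have ne : ∀ {x : v.adicCompletion K}, Valued.v x = 1 → x ≠ 0 := by
    rintro x hx rfl
    simp at hx
  -- Some coordinate is a unit; its term is the one adjusted by Hensel's lemma.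
  rcases h0 with h0 | h0 | h0
  · obtain ⟨t, ht0, ht⟩ := exists_mul_cube_add_eq_zero h3 (a := u * X ^ 3)
      (b := u ^ 2 * Y ^ 3 + n * Z ^ 3) (by rw [map_mul, map_pow, hu, h0]; simp)
      (by rwa [← add_assoc])
    exact ⟨X * t, Y, Z, .inl (mul_ne_zero (ne h0) ht0), by linear_combination ht⟩
  · obtain ⟨t, ht0, ht⟩ := exists_mul_cube_add_eq_zero h3 (a := u ^ 2 * Y ^ 3)
      (b := u * X ^ 3 + n * Z ^ 3) (by rw [map_mul, map_pow, map_pow, hu, h0]; simp)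
      (by rwa [← add_assoc, add_comm (u ^ 2 * Y ^ 3)])
    exact ⟨X, Y * t, Z, .inr (.inl (mul_ne_zero (ne h0) ht0)), by linear_combination ht⟩
  · obtain ⟨t, ht0, ht⟩ := exists_mul_cube_add_eq_zero h3 (a := n * Z ^ 3)
      (b := u * X ^ 3 + u ^ 2 * Y ^ 3) (by rw [map_mul, map_pow, hn1, h0]; simp)
      (by rwa [add_comm])
    exact ⟨X, Y, Z * t, .inr (.inr (mul_ne_zero (ne h0) ht0)), by linear_combination ht⟩

end LocalMap

/-! ### Primes `l ≡ 2 mod 3` -/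

section Inert

variable {K : Type*} [Field K] [NumberField K] {v : HeightOneSpectrum (𝓞 K)}

/-- Completing does not enlarge the value group. -/
lemma hasCubeValuation_completion_iff {x : K} :
    HasCubeValuation Valued.v (algebraMap K (v.adicCompletion K) x) ↔
      HasCubeValuation (v.valuation K) x := by
  constructor
  · rintro ⟨z, hz, h⟩
    obtain ⟨k, hk⟩ := v.valuation_surjective K (Valued.v z)
    rw [valued_coe_eq, ← hk] at h
    refine ⟨k, ?_, h⟩
    rintro rfl
    rw [map_zero, eq_comm, map_eq_zero] at hk
    exact hz hk
  · rintro ⟨z, hz, h⟩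
    exact ⟨algebraMap K _ z, (map_ne_zero _).mpr hz, by rw [valued_coe_eq, valued_coe_eq, h]⟩

/-- A generator of the prime has no cube valuation. -/
lemma not_hasCubeValuation_generator {r : 𝓞 K} (hr : r ≠ 0) (hv : v.asIdeal = Ideal.span {r}) :
    ¬ HasCubeValuation (v.valuation K) (r : K) := by
  rintro ⟨z, hz, h⟩
  have hz' : v.valuation K z ≠ 0 := (map_ne_zero _).mpr hz
  rw [v.valuation_of_algebraMap, v.intValuation_singleton hr hv,
    ← WithZero.exp_log hz', ← WithZero.exp_nsmul, WithZero.exp_inj] at h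
  simp at h
  omega

/-- The inertia degree is the order of `l` modulo `3`, which is `2`. -/
lemma absNorm_of_inert [IsCyclotomicExtension {3} ℚ K] {l : ℕ} (hl : l.Prime) (hl3 : l ≡ 2 [MOD 3]) (hv : (l : 𝓞 K) ∈ v.asIdeal) :
    Ideal.absNorm v.asIdeal = l ^ 2 := by
  have : Fact l.Prime := ⟨hl⟩
  have hlo : v.asIdeal.LiesOver (Ideal.span {(l : ℤ)}) := by
    have hmax : (Ideal.span {(l : ℤ)}).IsMaximal :=
      PrincipalIdealRing.isMaximal_of_irreducible (Nat.prime_iff_prime_int.mp hl).irreducible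
    refine ⟨hmax.eq_of_le (Ideal.IsPrime.ne_top (v.isPrime.under ℤ)) ?_⟩
    rw [Ideal.span_singleton_le_iff_mem, Ideal.under_def, Ideal.mem_comap]
    simpa using hv
  have h1 := IsCyclotomicExtension.Rat.inertiaDeg_eq_of_not_dvd (m := 3) l K v.asIdeal (by
    intro h
    rcases (Nat.dvd_prime Nat.prime_three).mp h with h | h
    · exact hl.one_lt.ne' h
    · subst h; exact absurd hl3 (by decide))
  have h2 : (l : ZMod 3) = 2 := (ZMod.natCast_eq_natCast_iff l 2 3).mpr hl3
  rw [h2, orderOf_eq_prime (p := 2) (by decide) (by decide)] at h1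
  rw [← Ideal.pow_inertiaDeg l, h1]

lemma absNorm_span_natCast [IsCyclotomicExtension {3} ℚ K] (l : ℕ) : Ideal.absNorm (Ideal.span {(l : 𝓞 K)}) = l ^ 2 := by
  have h1 := Algebra.norm_algebraMap_of_basis (RingOfIntegers.basis K) (l : ℤ)
  rw [← Module.finrank_eq_card_basis (RingOfIntegers.basis K), RingOfIntegers.rank,
    IsCyclotomicExtension.Rat.finrank 3 K, Nat.totient_prime Nat.prime_three] at h1
  rw [Ideal.absNorm_span_singleton]
  simp only [map_natCast] at h1
  rw [h1]
  simp [Int.natAbs_pow]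

/-- One ideal contains the other and both have norm `l²`. -/
lemma asIdeal_eq_span_of_inert [IsCyclotomicExtension {3} ℚ K] {l : ℕ} (hl : l.Prime) (hl3 : l ≡ 2 [MOD 3])
    (hv : (l : 𝓞 K) ∈ v.asIdeal) : v.asIdeal = Ideal.span {(l : 𝓞 K)} := by
  have hle : Ideal.span {(l : 𝓞 K)} ≤ v.asIdeal := (Ideal.span_singleton_le_iff_mem _).mpr hv
  obtain ⟨J, hJ⟩ := Ideal.dvd_iff_le.mpr hle
  have h := congrArg Ideal.absNorm hJ
  rw [map_mul, absNorm_of_inert hl hl3 hv, absNorm_span_natCast] at h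
  have : Ideal.absNorm J = 1 := by
    have hpos : 0 < l ^ 2 := pow_pos hl.pos 2
    exact Nat.eq_of_mul_eq_mul_left hpos (by rw [← h, mul_one])
  rw [Ideal.absNorm_eq_one_iff] at this
  rw [hJ, this, Ideal.mul_top]

lemma exists_inert_prime [IsCyclotomicExtension {3} ℚ K] {l : ℕ} (hl : l.Prime) :
    ∃ v : HeightOneSpectrum (𝓞 K), (l : 𝓞 K) ∈ v.asIdeal := by
  obtain ⟨M, hM, hle⟩ := Ideal.exists_le_maximal (Ideal.span {(l : 𝓞 K)}) (by
    intro h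
    have := absNorm_span_natCast (K := K) l
    rw [h, Ideal.absNorm_top] at this
    nlinarith [hl.two_le])
  have hmem := (Ideal.span_singleton_le_iff_mem _).mp hle
  refine ⟨⟨M, hM.isPrime, ?_⟩, hmem⟩
  rintro rfl
  exact hl.ne_zero (by exact_mod_cast (Ideal.mem_bot.mp hmem))

lemma coprime_three {l : ℕ} (hl3 : l ≡ 2 [MOD 3]) : l.Coprime 3 := by
  rw [Nat.coprime_comm, Nat.Prime.coprime_iff_not_dvd Nat.prime_three]
  unfold Nat.ModEq at hl3
  omega

lemma three_not_mem_of_inert {l : ℕ} (hl3 : l ≡ 2 [MOD 3])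
    (hv : (l : 𝓞 K) ∈ v.asIdeal) : (3 : 𝓞 K) ∉ v.asIdeal := by
  simpa using natCast_not_mem_of_coprime (coprime_three hl3) hv

/-- A rational integer prime to `l ≡ 2 mod 3` is an `l`-adic cube. -/
lemma exists_cube_root_natCast {l : ℕ} (hl : l.Prime) (hl3 : l ≡ 2 [MOD 3]) (hv : (l : 𝓞 K) ∈ v.asIdeal)
    {m : ℕ} (hm : l.Coprime m) : ∃ y : v.adicCompletion K, y ^ 3 = m := by
  have : Fact l.Prime := ⟨hl⟩
  obtain ⟨k, hk⟩ : ∃ k, l = 3 * k + 2 := ⟨l / 3, by unfold Nat.ModEq at hl3; omega⟩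
  have hm0 : (m : ZMod l) ≠ 0 := by
    rw [ne_eq, ZMod.natCast_eq_zero_iff]
    exact (Nat.Prime.coprime_iff_not_dvd hl).mp hm
  -- Raising to the power `2k + 1` inverts cubing on `(ℤ/l)ˣ`, because `3(2k + 1) = 2(l - 1) + 1`.
  obtain ⟨b, hb⟩ : ∃ b : ℕ, b = m ^ (2 * k + 1) := ⟨_, rfl⟩
  have hbm : (b : ZMod l) ^ 3 = m := by
    have h1 := ZMod.pow_card_sub_one_eq_one hm0
    rw [show l - 1 = 3 * k + 1 by omega] at h1
    rw [hb]; push_cast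
    rw [← pow_mul, show (2 * k + 1) * 3 = (3 * k + 1) * 2 + 1 by ring, pow_succ, pow_mul, h1]
    simp
  have hb1 : Valued.v (b : v.adicCompletion K) = 1 := by
    rw [natCast_eq_one_iff]
    refine natCast_not_mem_of_coprime ?_ hv
    rw [hb]
    exact Nat.Coprime.pow_right _ hm
  have hb0 : (b : v.adicCompletion K) ≠ 0 := by
    intro h
    rw [h] at hb1
    simp at hb1
  have hd : (l : ℤ) ∣ m - b ^ 3 := by
    rw [← ZMod.intCast_zmod_eq_zero_iff_dvd _ l]
    push_cast
    rw [hbm, sub_self]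
  obtain ⟨c, hc⟩ := hd
  have hc' : (m : v.adicCompletion K) - b ^ 3 = l * (c : ℤ) := by exact_mod_cast congrArg (Int.cast (R := v.adicCompletion K)) hc
  have h3 : (3 : 𝓞 K) ∉ v.asIdeal := by
    simpa using natCast_not_mem_of_coprime (coprime_three hl3) hv
  obtain ⟨y, hy⟩ := exists_cube_root_of_lt_one h3 (x := (m : v.adicCompletion K) / b ^ 3) (by
    rw [show (m : v.adicCompletion K) / b ^ 3 - 1 = (m - b ^ 3) / b ^ 3 by field_simp, hc', map_div₀,
      map_pow, hb1, one_pow, div_one, map_mul]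
    refine mul_lt_one_of_lt_of_le (natCast_lt_one_iff.mpr hv) ?_
    rw [← map_intCast (localMap v)]
    exact localMap_le_one _)
  exact ⟨y * b, by rw [mul_pow, hy]; field_simp⟩

lemma localMap_toInteger {ζ : K} (hζ : IsPrimitiveRoot ζ 3) : localMap v hζ.toInteger = algebraMap K (v.adicCompletion K) ζ := rfl

lemma toInteger_sub_one_sq {K : Type*} [Field K] {ζ : K} (hζ : IsPrimitiveRoot ζ 3) : (hζ.toInteger - 1) ^ 2 = -3 * hζ.toInteger := by
  have h := hζ.toInteger_isPrimitiveRoot.geom_sum_eq_zero (by norm_num)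
  simp only [Finset.sum_range_succ, Finset.sum_range_zero] at h
  linear_combination h

lemma toInteger_sub_one_not_mem {ζ : K} (hζ : IsPrimitiveRoot ζ 3) (h3 : (3 : 𝓞 K) ∉ v.asIdeal) :
    hζ.toInteger - 1 ∉ v.asIdeal := by
  intro h
  refine h3 ?_
  have e : (3 : 𝓞 K) = -(hζ.toInteger ^ 2 * (hζ.toInteger - 1)) * (hζ.toInteger - 1) := by
    have := toInteger_sub_one_sq hζ
    have h3 := hζ.toInteger_isPrimitiveRoot.pow_eq_one
    linear_combination hζ.toInteger ^ 2 * this - 3 * h3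
  rw [e]
  exact Ideal.mul_mem_left _ _ h

lemma card_residue_units [IsCyclotomicExtension {3} ℚ K] {l : ℕ} (hl : l.Prime) (hl3 : l ≡ 2 [MOD 3]) (hv : (l : 𝓞 K) ∈ v.asIdeal) :
    letI := Ideal.Quotient.field v.asIdeal
    Nat.card (𝓞 K ⧸ v.asIdeal)ˣ = l ^ 2 - 1 := by
  have := finite_residue v
  let := Ideal.Quotient.field v.asIdeal
  rw [Nat.card_units, ← absNorm_of_inert hl hl3 hv]
  rfl

/-- `ζ` is a cube at an inert prime `l ≡ 8 mod 9`. -/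
lemma exists_cube_root_zeta [IsCyclotomicExtension {3} ℚ K] {ζ : K} (hζ : IsPrimitiveRoot ζ 3) {l : ℕ} (hl : l.Prime) (hl9 : l ≡ 8 [MOD 9]) (hv : (l : 𝓞 K) ∈ v.asIdeal) :
    ∃ y : v.adicCompletion K, y ^ 3 = algebraMap K (v.adicCompletion K) ζ := by
  have hl3 : l ≡ 2 [MOD 3] := by
    unfold Nat.ModEq at *
    omega
  have h3 := three_not_mem_of_inert hl3 hv
  have := finite_residue v
  have hcard := card_residue_units hl hl3 hv
  let := Ideal.Quotient.field v.asIdeal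
  obtain ⟨g, hgen⟩ := IsCyclic.exists_generator (α := (𝓞 K ⧸ v.asIdeal)ˣ)
  have hg : orderOf g = l ^ 2 - 1 := hcard ▸ orderOf_eq_card_of_forall_mem_zpowers hgen
  let π := Ideal.Quotient.mk v.asIdeal
  obtain ⟨z, hz⟩ : ∃ z : (𝓞 K ⧸ v.asIdeal)ˣ, (z : 𝓞 K ⧸ v.asIdeal) = π hζ.toInteger :=
    ⟨Units.map π.toMonoidHom (hζ.toInteger_isPrimitiveRoot.isUnit (by norm_num)).unit, rfl⟩
  have hz3 : z ^ 3 = 1 := by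
    ext
    push_cast
    rw [hz, ← map_pow, hζ.toInteger_isPrimitiveRoot.pow_eq_one, map_one]
  obtain ⟨j, rfl⟩ : ∃ j : ℕ, g ^ j = z :=
    mem_powers_iff_mem_zpowers.mpr (hgen z)
  rw [← pow_mul, ← orderOf_dvd_iff_pow_eq_one, hg] at hz3
  have h9 : 9 ∣ l ^ 2 - 1 := by
    have h1 : l ^ 2 ≡ 8 ^ 2 [MOD 9] := hl9.pow 2
    unfold Nat.ModEq at h1
    have := Nat.one_le_pow 2 l hl.pos
    omega
  -- The image of `ζ` is `g^j` with `g` of order `l² - 1`; from `9 ∣ l² - 1 ∣ 3j` the exponent is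
  -- divisible by `3`, so the residue of `ζ` is a cube.
  have hj : 3 ∣ j := by
    obtain ⟨c, hc⟩ := h9.trans hz3
    omega
  obtain ⟨i, rfl⟩ := hj
  obtain ⟨b, hb⟩ := Ideal.Quotient.mk_surjective ((g ^ i : (𝓞 K ⧸ v.asIdeal)ˣ) : 𝓞 K ⧸ v.asIdeal)
  change π b = _ at hb
  have hmem : hζ.toInteger - b ^ 3 ∈ v.asIdeal := by
    rw [← Ideal.Quotient.eq_zero_iff_mem, map_sub, map_pow]
    change π _ - π b ^ 3 = 0
    rw [hb, ← hz]
    push_cast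
    ring
  have hb' : b ∉ v.asIdeal := by
    rw [← Ideal.Quotient.eq_zero_iff_mem]
    change π b ≠ 0
    rw [hb]
    exact Units.ne_zero _
  rw [← localMap_eq_one_iff] at hb'
  rw [← localMap_lt_one_iff, map_sub, map_pow] at hmem
  have hb0 : localMap v b ≠ 0 := by
    intro h
    rw [h] at hb'
    simp at hb'
  obtain ⟨y, hy⟩ := exists_cube_root_of_lt_one h3 (x := localMap v hζ.toInteger / localMap v b ^ 3) (by
    rw [show localMap v hζ.toInteger / localMap v b ^ 3 - 1 =
      (localMap v hζ.toInteger - localMap v b ^ 3) / localMap v b ^ 3 by field_simp, map_div₀,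
      map_pow, hb', one_pow, div_one]
    exact hmem)
  exact ⟨y * localMap v b, by rw [mul_pow, hy, ← localMap_toInteger hζ]; field_simp⟩

/-- `ζ` is not a cube at an inert prime `l ≢ 8 mod 9`. -/
lemma not_cube_zeta [IsCyclotomicExtension {3} ℚ K] {ζ : K} (hζ : IsPrimitiveRoot ζ 3) {l : ℕ} (hl : l.Prime) (hl3 : l ≡ 2 [MOD 3]) (hl9 : ¬ l ≡ 8 [MOD 9])
    (hv : (l : 𝓞 K) ∈ v.asIdeal) (y : v.adicCompletion K) :
    y ^ 3 ≠ algebraMap K (v.adicCompletion K) ζ := by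
  intro hy
  have h3 := three_not_mem_of_inert hl3 hv
  have := finite_residue v
  have hcard := card_residue_units hl hl3 hv
  let := Ideal.Quotient.field v.asIdeal
  rw [← localMap_toInteger hζ] at hy
  have hζ3 := hζ.toInteger_isPrimitiveRoot.pow_eq_one
  have hy1 : Valued.v y = 1 := by
    have : y ^ 9 = 1 := by rw [show 9 = 3 * 3 by rfl, pow_mul, hy, ← map_pow, hζ3, map_one]
    have h := congrArg Valued.v this
    rw [map_pow, map_one] at h
    exact (pow_eq_one_iff_of_nonneg zero_le (by norm_num)).mp h
  obtain ⟨b, hb⟩ := exists_localMap_near hy1.le one_ne_zero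
  rw [map_one] at hb
  have hmem : hζ.toInteger - b ^ 3 ∈ v.asIdeal := by
    rw [← localMap_lt_one_iff, map_sub, map_pow, ← hy, show y ^ 3 - localMap v b ^ 3 =
      (y - localMap v b) * (y ^ 2 + y * localMap v b + localMap v b ^ 2) by ring, map_mul]
    have hb1 := localMap_le_one (v := v) b
    refine mul_lt_one_of_lt_of_le hb (Valuation.map_add_le _ (Valuation.map_add_le _ ?_ ?_) ?_)
    · rw [map_pow, hy1, one_pow]
    · rw [map_mul, hy1, one_mul]; exact hb1
    · rw [map_pow]; exact pow_le_one' hb1 2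
  let π := Ideal.Quotient.mk v.asIdeal
  have hπ : π hζ.toInteger = π b ^ 3 := by
    rw [← map_pow]
    exact Ideal.Quotient.eq.mpr hmem
  have h9 : π b ^ 9 = 1 := by
    rw [show 9 = 3 * 3 by rfl, pow_mul, ← hπ, ← map_pow, hζ3, map_one]
  obtain ⟨w, hw⟩ : ∃ w : (𝓞 K ⧸ v.asIdeal)ˣ, (w : 𝓞 K ⧸ v.asIdeal) = π b :=
    ⟨Units.mk0 (π b) (by intro h; rw [h] at h9; simp at h9), rfl⟩
  -- The residue of `ζ` is nontrivial, so the residue of a cube root of it has order exactly `9`.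
  -- Then `9 ∣ l² - 1`, which fails for `l ≡ 2, 5 mod 9`.
  have : orderOf w = 3 ^ (1 + 1) := by
    have : Fact (Nat.Prime 3) := ⟨Nat.prime_three⟩
    refine orderOf_eq_prime_pow ?_ ?_
    · intro h
      have h' := congrArg Units.val h
      push_cast at h'
      rw [hw, ← hπ, ← map_one π] at h'
      exact toInteger_sub_one_not_mem hζ h3 (Ideal.Quotient.eq.mp h')
    · ext
      push_cast
      rw [hw]
      exact h9
  have hd := orderOf_dvd_natCard w
  rw [this, hcard] at hd
  have h1 : l ^ 2 % 9 = 1 := by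
    have := Nat.one_le_pow 2 l hl.pos
    omega
  rw [Nat.pow_mod] at h1
  unfold Nat.ModEq at hl3 hl9
  have : l % 9 < 9 := Nat.mod_lt _ (by norm_num)
  have h2 : l % 9 = 2 ∨ l % 9 = 5 := by omega
  rcases h2 with h | h <;> rw [h] at h1 <;> norm_num at h1

end Inert

/-! ### The prime above `3` -/

section Three

variable {K : Type*} [Field K] [NumberField K] {v : HeightOneSpectrum (𝓞 K)}

lemma exists_normalized {X Y Z : v.adicCompletion K} (h : X ≠ 0 ∨ Y ≠ 0 ∨ Z ≠ 0) :
    ∃ c : v.adicCompletion K, c ≠ 0 ∧ Valued.v (c * X) ≤ 1 ∧ Valued.v (c * Y) ≤ 1 ∧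
      Valued.v (c * Z) ≤ 1 ∧
      (Valued.v (c * X) = 1 ∨ Valued.v (c * Y) = 1 ∨ Valued.v (c * Z) = 1) := by
  obtain ⟨m, hm, hX, hY, hZ⟩ : ∃ m : v.adicCompletion K, (m = X ∨ m = Y ∨ m = Z) ∧
      Valued.v X ≤ Valued.v m ∧ Valued.v Y ≤ Valued.v m ∧ Valued.v Z ≤ Valued.v m := by
    rcases le_total (Valued.v X) (Valued.v Y) with h1 | h1 <;>
      rcases le_total (Valued.v Y) (Valued.v Z) with h2 | h2 <;>
      rcases le_total (Valued.v X) (Valued.v Z) with h3 | h3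
    · exact ⟨Z, by simp, h3, h2, le_rfl⟩
    · exact ⟨Z, by simp, h1.trans h2, h2, le_rfl⟩
    · exact ⟨Y, by simp, h1, le_rfl, h2⟩
    · exact ⟨Y, by simp, h1, le_rfl, h2⟩
    · exact ⟨Z, by simp, h3, h2, le_rfl⟩
    · exact ⟨X, by simp, le_rfl, h1, h3⟩
    · exact ⟨X, by simp, le_rfl, h1, h2.trans h1⟩
    · exact ⟨X, by simp, le_rfl, h1, h3⟩
  have hm0 : m ≠ 0 := by
    rintro rfl
    simp only [map_zero, nonpos_iff_eq_zero, map_eq_zero] at hX hY hZ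
    simp_all
  have hm1 : Valued.v m ≠ 0 := (map_ne_zero _).mpr hm0
  have hle : ∀ {x : v.adicCompletion K}, Valued.v x ≤ Valued.v m → Valued.v (m⁻¹ * x) ≤ 1 := by
    intro x hx
    rw [map_mul, map_inv₀, inv_mul_le_iff₀ (zero_lt_iff.mpr hm1), mul_one]
    exact hx
  have h1 : Valued.v (m⁻¹ * m) = 1 := by rw [inv_mul_cancel₀ hm0, map_one]
  refine ⟨m⁻¹, inv_ne_zero hm0, hle hX, hle hY, hle hZ, ?_⟩
  rcases hm with rfl | rfl | rfl
  · exact .inl h1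
  · exact .inr (.inl h1)
  · exact .inr (.inr h1)

lemma valued_three_lt_one (h3 : (3 : 𝓞 K) ∈ v.asIdeal) : Valued.v (3 : v.adicCompletion K) < 1 := by
  simpa using (natCast_lt_one_iff (v := v) (m := 3)).mpr (by simpa using h3)

lemma valued_intCast_le_one (m : ℤ) : Valued.v (m : v.adicCompletion K) ≤ 1 := by
  rw [← map_intCast (localMap v)]
  exact localMap_le_one _

lemma valued_intCast_eq_one (h3 : (3 : 𝓞 K) ∈ v.asIdeal) {m : ℤ} (hm : ¬ 3 ∣ m) :
    Valued.v (m : v.adicCompletion K) = 1 := by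
  have h := (natCast_eq_one_iff (v := v) (m := m.natAbs)).mpr (natCast_not_mem_of_coprime (a := 3)
    ((Nat.Prime.coprime_iff_not_dvd Nat.prime_three).mpr (by omega)) (by simpa using h3))
  rcases Int.natAbs_eq m with e | e
  · rw [e]; simpa using h
  · rw [e]; simpa using h

/-- At the prime above `3`, rational integers congruent to `1` modulo `9` are cubes. -/
lemma exists_cube_root_intCast (h3 : (3 : 𝓞 K) ∈ v.asIdeal) {m : ℤ} (hm : m % 9 = 1) :
    ∃ y : v.adicCompletion K, y ^ 3 = m := by
  -- Hensel's lemma needs a congruence finer than modulo `9`. The classes `1`, `10`, `19` modulo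
  -- `27` are the cubes of `1`, `4`, `7`.
  obtain ⟨b, c, hb, hc⟩ : ∃ b c : ℤ, ¬ 3 ∣ b ∧ m = b ^ 3 + 27 * c := by
    have : m % 27 = 1 ∨ m % 27 = 10 ∨ m % 27 = 19 := by omega
    rcases this with h | h | h
    · exact ⟨1, m / 27, by norm_num, by omega⟩
    · exact ⟨4, m / 27 - 2, by norm_num, by omega⟩
    · exact ⟨7, m / 27 - 12, by norm_num, by omega⟩
  have hb1 := valued_intCast_eq_one h3 hb
  have hb0 : (b : v.adicCompletion K) ≠ 0 := by
    intro h; rw [h] at hb1; simp at hb1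
  obtain ⟨y, hy⟩ := exists_cube_root v (x := (m : v.adicCompletion K) / b ^ 3) (by
    have e : (m : v.adicCompletion K) / b ^ 3 - 1 = 9 * (3 * c) / b ^ 3 := by
      rw [hc]; push_cast; field_simp; ring
    rw [e, map_div₀, map_pow, hb1, one_pow, div_one, map_mul]
    have h9 : (0 : WithZero (Multiplicative ℤ)) < Valued.v (9 : v.adicCompletion K) :=
      zero_lt_iff.mpr ((map_ne_zero _).mpr (by norm_num))
    refine mul_lt_of_lt_one_right h9 ?_
    rw [map_mul]
    exact mul_lt_one_of_lt_of_le (valued_three_lt_one h3) (valued_intCast_le_one c))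
  exact ⟨y * b, by rw [mul_pow, hy]; field_simp⟩

lemma cls_natCast_eq_one (h3 : (3 : 𝓞 K) ∈ v.asIdeal) {m : ℕ} (hm : m % 9 = 1 ∨ m % 9 = 8) :
    cls (m : v.adicCompletion K) = 1 := by
  rcases hm with hm | hm
  · obtain ⟨y, hy⟩ := exists_cube_root_intCast h3 (m := m) (by omega)
    rw [← Int.cast_natCast, ← hy, cls_cube]
  · obtain ⟨y, hy⟩ := exists_cube_root_intCast h3 (m := -m) (by omega)
    have : (m : v.adicCompletion K) = (-y) ^ 3 := by
      rw [Odd.neg_pow (by decide), hy]; simp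
    rw [this, cls_cube]

variable [IsCyclotomicExtension {3} ℚ K] {ζ : K} (hζ : IsPrimitiveRoot ζ 3)

lemma toInteger_sub_one_mem (h3 : (3 : 𝓞 K) ∈ v.asIdeal) : hζ.toInteger - 1 ∈ v.asIdeal := by
  refine v.isPrime.mem_of_pow_mem 2 ?_
  rw [toInteger_sub_one_sq]
  exact Ideal.mul_mem_right _ _ (neg_mem h3)

lemma valued_three :
    Valued.v (3 : v.adicCompletion K) = Valued.v (localMap v (hζ.toInteger - 1)) ^ 2 := by
  have hu : Valued.v (localMap v hζ.toInteger) = 1 := by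
    have := congrArg (fun x => Valued.v (localMap v x)) hζ.toInteger_isPrimitiveRoot.pow_eq_one
    simp only [map_pow, map_one] at this
    exact (pow_eq_one_iff_of_nonneg zero_le (by norm_num)).mp this
  rw [← map_pow, ← map_pow, toInteger_sub_one_sq, map_mul, map_mul, hu, mul_one, map_neg,
    Valuation.map_neg, map_ofNat (localMap v)]

/-- At the prime above `3` every integral element is congruent to `0`, `1` or `-1`. -/
lemma exists_digit {x : v.adicCompletion K} (hx : Valued.v x ≤ 1) :
    ∃ ε : ℤ, (ε = 0 ∨ ε = 1 ∨ ε = -1) ∧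
      Valued.v (x - ε) ≤ Valued.v (localMap v (hζ.toInteger - 1)) := by
  have hl0 : localMap v (hζ.toInteger - 1) ≠ 0 := by
    intro h
    have := valued_three (v := v) hζ
    rw [h, map_zero, zero_pow two_ne_zero, map_eq_zero] at this
    norm_num at this
  obtain ⟨a, ha⟩ := exists_localMap_near hx hl0
  have key : ∀ ε : ℤ, hζ.toInteger - 1 ∣ a - ε →
      Valued.v (x - ε) ≤ Valued.v (localMap v (hζ.toInteger - 1)) := by
    rintro ε ⟨b, hb⟩
    have hb' := congrArg (localMap v) hb
    rw [map_sub, map_mul, map_intCast] at hb'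
    rw [show x - ε = (x - localMap v a) + (localMap v a - ε) by ring, hb']
    refine Valuation.map_add_le _ ha.le ?_
    rw [map_mul]
    exact mul_le_of_le_one_right' (localMap_le_one b)
  rcases IsCyclotomicExtension.Rat.Three.lambda_dvd_or_dvd_sub_one_or_dvd_add_one hζ a with h | h | h
  · exact ⟨0, by simp, key 0 (by simpa using h)⟩
  · exact ⟨1, by simp, key 1 (by simpa using h)⟩
  · exact ⟨-1, by simp, key (-1) (by simpa using h)⟩

/-- Since `3` has order `2` at `λ = ζ - 1`, a nonzero rational integer has even order; order at
least `3` therefore means at least `4`. -/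
lemma nine_dvd_of_valued_le (h3 : (3 : 𝓞 K) ∈ v.asIdeal) {N : ℤ}
    (hN : Valued.v (N : v.adicCompletion K) ≤ Valued.v (localMap v (hζ.toInteger - 1)) ^ 3) :
    9 ∣ N := by
  have hq : Valued.v (localMap v (hζ.toInteger - 1)) < 1 :=
    localMap_lt_one_iff.mpr (toInteger_sub_one_mem hζ h3)
  have h3' := valued_three (v := v) hζ
  have hq0 : 0 < Valued.v (localMap v (hζ.toInteger - 1)) := by
    rw [zero_lt_iff]
    intro h
    rw [h, zero_pow two_ne_zero, map_eq_zero] at h3'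
    norm_num at h3'
  generalize Valued.v (localMap v (hζ.toInteger - 1)) = q at *
  by_cases h1 : 3 ∣ N
  · obtain ⟨M, rfl⟩ := h1
    by_cases h2 : 3 ∣ M
    · obtain ⟨M, rfl⟩ := h2
      exact ⟨M, by ring⟩
    · push_cast at hN
      rw [map_mul, valued_intCast_eq_one h3 h2, mul_one, h3'] at hN
      exact absurd hN (not_le.mpr (pow_lt_pow_right_of_lt_one₀ hq0 hq (by norm_num)))
  · rw [valued_intCast_eq_one h3 h1] at hN
    exact absurd hN (not_le.mpr (pow_lt_one₀ zero_le hq (by norm_num)))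

/-- With `ε³ = ε`, the difference is `3(x - ε)εx + (x - ε)³`. The factor `3` contributes order `2`
at `λ = ζ - 1`, so both summands have order at least `3`. -/
lemma valued_cube_sub_le (h3 : (3 : 𝓞 K) ∈ v.asIdeal) {x : v.adicCompletion K} {ε : ℤ}
    (hε : ε = 0 ∨ ε = 1 ∨ ε = -1)
    (h : Valued.v (x - ε) ≤ Valued.v (localMap v (hζ.toInteger - 1))) :
    Valued.v (x ^ 3 - ε) ≤ Valued.v (localMap v (hζ.toInteger - 1)) ^ 3 := by
  have hq : Valued.v (localMap v (hζ.toInteger - 1)) < 1 :=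
    localMap_lt_one_iff.mpr (toInteger_sub_one_mem hζ h3)
  have h3' := valued_three (v := v) hζ
  have hε3 : (ε : v.adicCompletion K) = ε ^ 3 := by
    rcases hε with rfl | rfl | rfl <;> norm_num
  have e : x ^ 3 - ε = 3 * (x - ε) * (ε * x) + (x - ε) ^ 3 := by
    linear_combination -hε3
  have hε1 := valued_intCast_le_one (v := v) ε
  have hx1 : Valued.v x ≤ 1 := by
    rw [show x = (x - ε) + ε by ring]
    exact Valuation.map_add_le _ (h.trans hq.le) hε1
  rw [e]
  refine Valuation.map_add_le _ ?_ (by rw [map_pow]; exact pow_le_pow_left₀ zero_le h 3)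
  rw [map_mul, map_mul, map_mul, h3', pow_succ _ 2]
  refine mul_le_of_le_of_le_one ?_ (mul_le_one' hε1 hx1)
  exact mul_le_mul' le_rfl h

/-- A primitive solution of `2X³ + 4Y³ + nZ³ = 0` is reduced modulo `λ³`, where cubes become digits
`0`, `±1`. As `n ≡ 1`, this gives `9 ∣ 2a + 4b + d`; the sum is at most `7` in absolute value, hence
zero, which forces all digits to vanish and contradicts primitivity. -/
lemma two_not_mem_kummerImage {ζ : K} (hζ : IsPrimitiveRoot ζ 3) (h3 : (3 : 𝓞 K) ∈ v.asIdeal) {n : ℕ} [NeZero n] (hn : n % 9 = 1)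
    {ξ : v.adicCompletion K} (hξ : IsPrimitiveRoot ξ 3) :
    pair (cls (2 : v.adicCompletion K)) ∉ kummerImage n hξ := by
  rw [pair_mem_kummerImage_iff hξ two_ne_zero]
  rintro ⟨X, Y, Z, h0, h⟩
  obtain ⟨c, hc0, hX, hY, hZ, h1⟩ := exists_normalized h0
  replace h : 2 * (c * X) ^ 3 + 2 ^ 2 * (c * Y) ^ 3 + n * (c * Z) ^ 3 = 0 := by
    linear_combination c ^ 3 * h
  generalize c * X = X at *
  generalize c * Y = Y at *
  generalize c * Z = Z at *
  obtain ⟨a, ha, hXa⟩ := exists_digit hζ hX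
  obtain ⟨b, hb, hYb⟩ := exists_digit hζ hY
  obtain ⟨d, hd, hZd⟩ := exists_digit hζ hZ
  have hN : 9 ∣ 2 * a + 4 * b + n * d := by
    refine nine_dvd_of_valued_le hζ h3 ?_
    have e : ((2 * a + 4 * b + n * d : ℤ) : v.adicCompletion K) =
        (-2 : ℤ) * (X ^ 3 - a) + ((-4 : ℤ) * (Y ^ 3 - b) + (-n : ℤ) * (Z ^ 3 - d)) := by
      push_cast
      linear_combination h
    have hm : ∀ (m : ℤ) {x y : v.adicCompletion K}, Valued.v x ≤ Valued.v y →
        Valued.v (m * x) ≤ Valued.v y := by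
      intro m x y hxy
      rw [map_mul]
      exact (mul_le_of_le_one_left' (valued_intCast_le_one m)).trans hxy
    rw [e, ← map_pow]
    refine Valuation.map_add_le _ (hm _ ?_) (Valuation.map_add_le _ (hm _ ?_) (hm _ ?_)) <;>
      rw [map_pow]
    · exact valued_cube_sub_le hζ h3 ha hXa
    · exact valued_cube_sub_le hζ h3 hb hYb
    · exact valued_cube_sub_le hζ h3 hd hZd
  have hnd : 9 ∣ 2 * a + 4 * b + d := by
    obtain ⟨k, hk⟩ : (9 : ℤ) ∣ n - 1 := by omega
    rw [show (n : ℤ) = 9 * k + 1 by omega] at hN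
    obtain ⟨j, hj⟩ := hN
    exact ⟨j - k * d, by linear_combination hj⟩
  have hq : Valued.v (localMap v (hζ.toInteger - 1)) < 1 :=
    localMap_lt_one_iff.mpr (toInteger_sub_one_mem hζ h3)
  have h000 : a = 0 ∧ b = 0 ∧ d = 0 := by omega
  obtain ⟨rfl, rfl, rfl⟩ := h000
  simp only [Int.cast_zero, sub_zero] at hXa hYb hZd
  rcases h1 with h1 | h1 | h1
  · exact absurd h1 (hXa.trans_lt hq).ne
  · exact absurd h1 (hYb.trans_lt hq).ne
  · exact absurd h1 (hZd.trans_lt hq).ne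

variable (K) in
lemma exists_prime_over_three : ∃ v : HeightOneSpectrum (𝓞 K), (3 : 𝓞 K) ∈ v.asIdeal := by
  obtain ⟨M, hM, hle⟩ := Ideal.exists_le_maximal (Ideal.span {((3 : ℕ) : 𝓞 K)}) (by
    intro h
    have := absNorm_span_natCast (K := K) 3
    rw [h, Ideal.absNorm_top] at this
    norm_num at this)
  have hmem := (Ideal.span_singleton_le_iff_mem _).mp hle
  refine ⟨⟨M, hM.isPrime, ?_⟩, by simpa using hmem⟩
  rintro rfl
  have := Ideal.mem_bot.mp hmem
  norm_num at this

end Three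

/-! ### Global classes with restricted valuations -/

section Factorization

variable {K : Type*} [Field K] [NumberField K] [IsCyclotomicExtension {3} ℚ K]

/-- Induction on proper divisibility: an irreducible factor of `x` either generates the same ideal
as `l₁` or `l₂`, which is split off, or occurs at least three times, and its cube is split off. What
remains is a unit `±ζ^i`, and `-1` is a cube. -/
lemma exists_integer_factorization {ζ : K} (hζ : IsPrimitiveRoot ζ 3) {l₁ l₂ : ℕ} (hl₁ : l₁.Prime)
    (hl₂ : l₂.Prime) (hl₁3 : l₁ ≡ 2 [MOD 3]) (hl₂3 : l₂ ≡ 2 [MOD 3]) (x : 𝓞 K) (hx : x ≠ 0)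
    (h : ∀ v : HeightOneSpectrum (𝓞 K), (l₁ : 𝓞 K) ∉ v.asIdeal → (l₂ : 𝓞 K) ∉ v.asIdeal →
      HasCubeValuation (v.valuation K) (x : K)) :
    ∃ (a b c : ℕ) (w : 𝓞 K), x = hζ.toInteger ^ a * l₁ ^ b * l₂ ^ c * w ^ 3 := by
  have := IsCyclotomicExtension.Rat.three_pid K
  induction x using (wellFounded_dvdNotUnit (α := 𝓞 K)).induction with | _ x ih
  by_cases hu : IsUnit x
  · obtain ⟨u, rfl⟩ := hu
    have := IsCyclotomicExtension.Rat.Three.Units.mem hζ u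
    simp only [List.mem_cons, List.not_mem_nil, or_false] at this
    rcases this with rfl | rfl | rfl | rfl | rfl | rfl
    · exact ⟨0, 0, 0, 1, by simp⟩
    · exact ⟨0, 0, 0, -1, by simp [Odd.neg_pow (show Odd 3 by decide)]⟩
    · exact ⟨1, 0, 0, 1, by simp⟩
    · exact ⟨1, 0, 0, -1, by simp [Odd.neg_pow (show Odd 3 by decide)]⟩
    · exact ⟨2, 0, 0, 1, by simp⟩
    · exact ⟨2, 0, 0, -1, by simp [Odd.neg_pow (show Odd 3 by decide)]⟩
  obtain ⟨i, hi, hix⟩ := WfDvdMonoid.exists_irreducible_factor hu hx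
  have hp := hi.prime
  let v : HeightOneSpectrum (𝓞 K) := ⟨Ideal.span {i}, (Ideal.span_singleton_prime hp.ne_zero).mpr hp,
    by simpa using hp.ne_zero⟩
  have hv : v.asIdeal = Ideal.span {i} := rfl
  have hxv : x ∈ v.asIdeal := by rw [hv, Ideal.mem_span_singleton]; exact hix
  have step : ∀ {l : ℕ}, l.Prime → l ≡ 2 [MOD 3] → (l = l₁ ∨ l = l₂) → (l : 𝓞 K) ∈ v.asIdeal →
      ∃ y : 𝓞 K, x = l * y ∧ ∃ (a b c : ℕ) (w : 𝓞 K),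
        y = hζ.toInteger ^ a * l₁ ^ b * l₂ ^ c * w ^ 3 := by
    intro l hl hl3 hll hlv
    have hl0 : (l : K) ≠ 0 := by exact_mod_cast hl.ne_zero
    rw [asIdeal_eq_span_of_inert hl hl3 hlv, Ideal.mem_span_singleton] at hxv
    obtain ⟨y, rfl⟩ := hxv
    have hy : y ≠ 0 := right_ne_zero_of_mul hx
    refine ⟨y, rfl, ih y ⟨hy, l, ?_, mul_comm _ _⟩ hy fun w h1 h2 => ?_⟩
    · intro hlu
      exact v.isPrime.ne_top (Ideal.eq_top_of_isUnit_mem _ hlv hlu)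
    · have hlw : w.valuation K (l : K) = 1 := by
        have : (l : 𝓞 K) ∉ w.asIdeal := by rcases hll with rfl | rfl <;> assumption
        have := (w.valuation_eq_one_iff_notMem (K := K)).mpr this
        rwa [map_natCast] at this
      have := (h w h1 h2).mul (hasCubeValuation_of_eq_one hlw).inv
      push_cast at this
      rwa [mul_comm (l : K), mul_inv_cancel_right₀ hl0] at this
  by_cases h1 : (l₁ : 𝓞 K) ∈ v.asIdeal
  · obtain ⟨y, rfl, a, b, c, w, rfl⟩ := step hl₁ hl₁3 (.inl rfl) h1
    exact ⟨a, b + 1, c, w, by ring⟩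
  by_cases h2 : (l₂ : 𝓞 K) ∈ v.asIdeal
  · obtain ⟨y, rfl, a, b, c, w, rfl⟩ := step hl₂ hl₂3 (.inr rfl) h2
    exact ⟨a, b, c + 1, w, by ring⟩
  -- The order of `x` at `v` is positive and divisible by `3`, hence at least `3`.
  have hi3 : i ^ 3 ∣ x := by
    obtain ⟨z, hz, e⟩ := h v h1 h2
    have hz' : v.valuation K z ≠ 0 := (map_ne_zero _).mpr hz
    rw [v.valuation_of_algebraMap] at e
    have hlt := (v.intValuation_lt_one_iff_mem x).mpr hxv
    have := (v.intValuation_le_pow_iff_mem x 3).mp (by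
      rw [e, ← WithZero.exp_log hz', ← WithZero.exp_zero, ← WithZero.exp_nsmul,
        WithZero.exp_lt_exp] at hlt
      rw [e, ← WithZero.exp_log hz', ← WithZero.exp_nsmul, WithZero.exp_le_exp]
      simp at hlt ⊢
      omega)
    rwa [hv, Ideal.span_singleton_pow, Ideal.mem_span_singleton] at this
  obtain ⟨y, rfl⟩ := hi3
  have hy : y ≠ 0 := right_ne_zero_of_mul hx
  have hi0 : (i : K) ≠ 0 := by exact_mod_cast hp.ne_zero
  obtain ⟨a, b, c, w, rfl⟩ := ih y ⟨hy, i ^ 3, fun hu => hi.not_isUnit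
    (isUnit_of_dvd_unit (dvd_pow_self i (by norm_num)) hu), mul_comm _ _⟩ hy fun w h1 h2 => by
      have := h w h1 h2
      push_cast at this
      rwa [mul_comm, hasCubeValuation_mul_cube_iff hi0] at this
  exact ⟨a, b, c, w * i, by ring⟩

/-- An element of `K` whose valuations away from `l₁`, `l₂` are cubes is, up to cubes, a product
of powers of `ζ`, `l₁` and `l₂`. -/
lemma exists_factorization {ζ : K} (hζ : IsPrimitiveRoot ζ 3) {l₁ l₂ : ℕ} (hl₁ : l₁.Prime)
    (hl₂ : l₂.Prime) (hl₁3 : l₁ ≡ 2 [MOD 3]) (hl₂3 : l₂ ≡ 2 [MOD 3]) {u : K} (hu : u ≠ 0)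
    (h : ∀ v : HeightOneSpectrum (𝓞 K), (l₁ : 𝓞 K) ∉ v.asIdeal → (l₂ : 𝓞 K) ∉ v.asIdeal →
      HasCubeValuation (v.valuation K) u) :
    ∃ (a b c : ℕ) (w : K), u = ζ ^ a * l₁ ^ b * l₂ ^ c * w ^ 3 := by
  obtain ⟨x, y, hy, rfl⟩ := IsFractionRing.div_surjective (A := 𝓞 K) u
  have hy0 : (y : K) ≠ 0 := by simpa using nonZeroDivisors.ne_zero hy
  have hx0 : (x : K) ≠ 0 := by rintro h; apply hu; change (x : K) / _ = 0; rw [h, zero_div]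
  -- Multiplying `x/y` by `y³` gives an integral element of the same cube class.
  obtain ⟨a, b, c, w, e⟩ := exists_integer_factorization hζ hl₁ hl₂ hl₁3 hl₂3 (x * y ^ 2)
    (mul_ne_zero (by simpa using hx0) (pow_ne_zero 2 (by simpa using hy0))) fun v h1 h2 => by
      have := (hasCubeValuation_mul_cube_iff hy0).mpr (h v h1 h2)
      convert! this using 1
      push_cast
      change (x : K) * y ^ 2 = (x : K) / (y : K) * (y : K) ^ 3
      field_simp
  refine ⟨a, b, c, w / y, ?_⟩
  have e' := congrArg (algebraMap (𝓞 K) K) e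
  simp only [map_mul, map_pow, map_natCast] at e'
  change (x : K) * (y : K) ^ 2 = ζ ^ a * _ * _ * (w : K) ^ 3 at e'
  change (x : K) / (y : K) = _
  field_simp
  linear_combination e'

end Factorization

/-! ### Computing with cube classes -/

section Classes

lemma cls_pow {F : Type*} [Field F] {a : F} (ha : a ≠ 0) (k : ℕ) : cls (a ^ k) = cls a ^ k := by
  rw [cls_of_ne ha, cls_of_ne (pow_ne_zero k ha), ← map_pow]
  congr 1
  ext
  simp

lemma exists_cls_eq {F : Type*} [Field F] (x : CubeClass F) : ∃ u : F, u ≠ 0 ∧ x = cls u := by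
  obtain ⟨u, rfl⟩ := CubeClass.mk_surjective x
  exact ⟨u, u.ne_zero, by rw [cls_of_ne u.ne_zero, Units.mk0_val]⟩

lemma cls_eq_one_iff {F : Type*} [Field F] {a : F} (ha : a ≠ 0) : cls a = 1 ↔ ∃ w : F, w ^ 3 = a := by
  constructor
  · rw [cls_of_ne ha, CubeClass.mk_eq_one_iff]
    rintro ⟨w, hw⟩
    exact ⟨w, by simpa using congrArg Units.val hw⟩
  · rintro ⟨w, rfl⟩
    exact cls_cube w

lemma map_cls (K F : Type*) [Field K] [Field F] [Algebra K F] {a : K} (ha : a ≠ 0) :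
    CubeClass.map K F (cls a) = cls (algebraMap K F a) := by
  rw [cls_of_ne ha, cls_of_ne ((map_ne_zero _).mpr ha)]
  change CubeClass.mk _ = _
  congr 1
  ext
  rfl

lemma CubeClass.eq_one_of_pow_eq_one {F : Type*} [Field F] {x : CubeClass F} {a : ℕ}
    (ha : ¬ 3 ∣ a) (h : x ^ a = 1) : x = 1 := by
  have h1 : orderOf x ∣ 1 := by
    rw [← (Nat.Prime.coprime_iff_not_dvd Nat.prime_three).mpr ha]
    exact Nat.dvd_gcd (orderOf_dvd_of_pow_eq_one (CubeClass.pow_three x))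
      (orderOf_dvd_of_pow_eq_one h)
  exact orderOf_eq_one_iff.mp (Nat.dvd_one.mp h1)

lemma CubeClass.mem_of_pow_mem {F : Type*} [Field F] {H : Subgroup (CubeClass F)} {x : CubeClass F}
    {a : ℕ} (ha : ¬ 3 ∣ a) (h : x ^ a ∈ H) : x ∈ H := by
  have h3 : a % 3 = 1 ∨ a % 3 = 2 := by omega
  rw [← pow_mod_three] at h
  rcases h3 with e | e <;> rw [e] at h
  · simpa using h
  · have := H.mul_mem h h
    rwa [← pow_add, ← pow_mod_three, show (2 + 2) % 3 = 1 by rfl, pow_one] at this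

end Classes

/-! ### Local conditions and the Selmer group -/

section Selmer

variable {K : Type*} [Field K] [NumberField K]

/-- The classes which are second components of elements of the local image. -/
noncomputable def localClasses (n : ℕ) [NeZero n] {F : Type*} [Field F] [CharZero F] {ξ : F}
    (hξ : IsPrimitiveRoot ξ 3) : Subgroup (CubeClass F) :=
  (kummerImage n hξ).comap pair

lemma mem_localClasses {n : ℕ} [NeZero n] {F : Type*} [Field F] [CharZero F] {ξ : F}
    {hξ : IsPrimitiveRoot ξ 3} {x : CubeClass F} :
    x ∈ localClasses n hξ ↔ pair x ∈ kummerImage n hξ := Iff.rfl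

lemma cls_natCast_mem_localClasses {n : ℕ} [NeZero n] {F : Type*} [Field F] [CharZero F] {ξ : F}
    (hξ : IsPrimitiveRoot ξ 3) : cls (n : F) ∈ localClasses n hξ := by
  rw [mem_localClasses, pair_mem_kummerImage_iff hξ (natCast_ne n F)]
  exact ⟨1, 0, -1, by simp, by ring⟩

lemma exists_of_mem_selmer {n : ℕ} [NeZero n] {ζ : K} {hζ : IsPrimitiveRoot ζ 3}
    {x : CubeClass K × CubeClass K} (hx : x ∈ selmer n hζ) :
    ∃ u : K, u ≠ 0 ∧ x = pair (cls u) := by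
  obtain ⟨u, hu, e⟩ := exists_cls_eq x.2
  exact ⟨u, hu, by rw [← e]; exact mem_normOne_iff.mp hx.1⟩

lemma pair_mem_selmer_iff {n : ℕ} [NeZero n] {ζ : K} {hζ : IsPrimitiveRoot ζ 3} {u : K}
    (hu : u ≠ 0) : pair (cls u) ∈ selmer n hζ ↔ ∀ v : HeightOneSpectrum (𝓞 K),
      cls (algebraMap K (v.adicCompletion K) u) ∈
        localClasses n (hζ.map_of_injective (algebraMap K (v.adicCompletion K)).injective) := by
  rw [selmer, Subgroup.mem_inf, and_iff_right (mem_normOne_iff.mpr rfl), Subgroup.mem_iInf]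
  refine forall_congr' fun v => ?_
  rw [Subgroup.mem_comap, mem_localClasses, ← map_cls K (v.adicCompletion K) hu]
  simp only [pair_apply, MonoidHom.prodMap_def, MonoidHom.prod_apply, MonoidHom.coe_comp,
    Function.comp_apply, MonoidHom.coe_fst, MonoidHom.coe_snd, map_inv]

lemma cls_natCast_mem_selmer {n : ℕ} [NeZero n] {ζ : K} (hζ : IsPrimitiveRoot ζ 3) :
    pair (cls (n : K)) ∈ selmer n hζ := by
  rw [pair_mem_selmer_iff (natCast_ne n K)]
  intro v
  rw [map_natCast]
  exact cls_natCast_mem_localClasses _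

variable {v : HeightOneSpectrum (𝓞 K)}

/-- Classes in the local image have cube valuation at primes not dividing `n`. -/
lemma hasCubeValuation_of_mem {n : ℕ} [NeZero n] {ξ : v.adicCompletion K}
    {hξ : IsPrimitiveRoot ξ 3} (hn : (n : 𝓞 K) ∉ v.asIdeal) {u : v.adicCompletion K} (hu : u ≠ 0)
    (h : cls u ∈ localClasses n hξ) : HasCubeValuation Valued.v u := by
  obtain ⟨X, Y, Z, h0, h⟩ := (pair_mem_kummerImage_iff hξ hu).mp h
  exact .of_solution hu (natCast_eq_one_iff.mpr hn) h0 h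

/-- At a prime where `n` has no cube valuation, the local image contains no nontrivial class of
cube valuation. -/
lemma cls_eq_one_of_mem {n : ℕ} [NeZero n] {ξ : v.adicCompletion K}
    {hξ : IsPrimitiveRoot ξ 3} (h3 : (3 : 𝓞 K) ∉ v.asIdeal)
    (hn : ¬ HasCubeValuation Valued.v (n : v.adicCompletion K)) {u : v.adicCompletion K}
    (hu : u ≠ 0) (hu' : HasCubeValuation Valued.v u) (h : cls u ∈ localClasses n hξ) :
    cls u = 1 := by
  obtain ⟨X, Y, Z, h0, h⟩ := (pair_mem_kummerImage_iff hξ hu).mp h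
  obtain ⟨t, ht, hlt⟩ := exists_cube_near_of_solution hu (natCast_ne n _) hu' hn h0 h
  obtain ⟨y, hy⟩ := exists_cube_root_of_lt_one h3 hlt
  rw [cls_eq_one_iff hu]
  exact ⟨y / t, by rw [div_pow, hy]; field_simp⟩

variable [IsCyclotomicExtension {3} ℚ K] {ζ : K}

lemma cls_natCast_of_inert {l m : ℕ} (hl : l.Prime) (hl3 : l ≡ 2 [MOD 3])
    (hv : (l : 𝓞 K) ∈ v.asIdeal) (hm : l.Coprime m) : cls (m : v.adicCompletion K) = 1 := by
  obtain ⟨y, hy⟩ := exists_cube_root_natCast hl hl3 hv hm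
  rw [← hy, cls_cube]

lemma not_hasCubeValuation_of_inert {l : ℕ} (hl : l.Prime) (hl3 : l ≡ 2 [MOD 3])
    (hv : (l : 𝓞 K) ∈ v.asIdeal) : ¬ HasCubeValuation Valued.v (l : v.adicCompletion K) := by
  have := not_hasCubeValuation_generator (r := (l : 𝓞 K)) (by exact_mod_cast hl.ne_zero)
    (asIdeal_eq_span_of_inert hl hl3 hv)
  rw [← hasCubeValuation_completion_iff] at this
  simpa using this

lemma HasCubeValuation.pow_three_dvd {l b : ℕ} {F Γ : Type*} [Field F]
    [LinearOrderedCommGroupWithZero Γ] {w : Valuation F Γ} (hl0 : (l : F) ≠ 0)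
    (hl : ¬ HasCubeValuation w (l : F)) (h : HasCubeValuation w ((l : F) ^ b)) : 3 ∣ b := by
  by_contra hb
  have hk : ∃ k, b = 3 * k + 1 ∨ b = 3 * k + 2 := ⟨b / 3, by omega⟩
  obtain ⟨k, rfl | rfl⟩ := hk
  · rw [pow_add, mul_comm 3, pow_mul, pow_one, mul_comm,
      hasCubeValuation_mul_cube_iff (pow_ne_zero k hl0)] at h
    exact hl h
  · rw [pow_add, mul_comm 3, pow_mul, mul_comm,
      hasCubeValuation_mul_cube_iff (pow_ne_zero k hl0)] at h
    exact hl (.of_sq hl0 h)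

lemma valued_zeta (hζ : IsPrimitiveRoot ζ 3) :
    Valued.v (algebraMap K (v.adicCompletion K) ζ) = 1 := by
  have := congrArg (fun x => Valued.v (algebraMap K (v.adicCompletion K) x)) hζ.pow_eq_one
  simp only [map_pow, map_one] at this
  exact (pow_eq_one_iff_of_nonneg zero_le (by norm_num)).mp this

/-- If `l ≢ 8 mod 9`, the local condition at `l` forces the exponent of `ζ` to be divisible by `3`. -/
lemma dvd_exponent_of_mem {l l' e n a b c : ℕ} [NeZero n] (hζ : IsPrimitiveRoot ζ 3)
    (hl : l.Prime) (hl' : l'.Prime) (hne : l ≠ l') (hl3 : l ≡ 2 [MOD 3]) (hl9 : ¬ l ≡ 8 [MOD 9])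
    (he : e = 1 ∨ e = 2) (hn : n = (l * l') ^ e)
    (hmem : pair (cls (ζ ^ a * l ^ b * l' ^ c)) ∈ selmer n hζ) : 3 ∣ a := by
  by_contra ha
  obtain ⟨v, hv⟩ := exists_inert_prime (K := K) hl
  have h3 := three_not_mem_of_inert hl3 hv
  have hζ0 : ζ ≠ 0 := hζ.ne_zero (by norm_num)
  have hl0 : (l : K) ≠ 0 := by exact_mod_cast hl.ne_zero
  have hl'0 : (l' : K) ≠ 0 := by exact_mod_cast hl'.ne_zero
  have hu0 : ζ ^ a * (l : K) ^ b * (l' : K) ^ c ≠ 0 := by simp [*]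
  obtain ⟨ξ, hξ, hloc⟩ : ∃ (ξ : v.adicCompletion K) (hξ : IsPrimitiveRoot ξ 3),
      cls (algebraMap K (v.adicCompletion K) (ζ ^ a * (l : K) ^ b * (l' : K) ^ c)) ∈
        localClasses n hξ := ⟨_, _, (pair_mem_selmer_iff hu0).mp hmem v⟩
  have hcop : l.Coprime l' := (Nat.coprime_primes hl hl').mpr hne
  have hLl' : Valued.v (l' : v.adicCompletion K) = 1 :=
    natCast_eq_one_iff.mpr (natCast_not_mem_of_coprime hcop hv)
  have hL0 : (l : v.adicCompletion K) ≠ 0 := by exact_mod_cast hl.ne_zero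
  have hL'0 : (l' : v.adicCompletion K) ≠ 0 := by exact_mod_cast hl'.ne_zero
  have hZ0 : algebraMap K (v.adicCompletion K) ζ ≠ 0 := (map_ne_zero _).mpr hζ0
  have hZ1 : Valued.v (algebraMap K (v.adicCompletion K) ζ) = 1 := valued_zeta hζ
  have hnl := not_hasCubeValuation_of_inert hl hl3 hv
  have hn' : (n : v.adicCompletion K) = (l : v.adicCompletion K) ^ e * (l' : v.adicCompletion K) ^ e := by
    rw [hn]; push_cast; ring
  simp only [map_mul, map_pow, map_natCast] at hloc
  generalize hZ : algebraMap K (v.adicCompletion K) ζ = Z at *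
  -- Multiplying by `n^k`, which stays in the local image, makes the exponent of `l` divisible by
  -- `3`. The class is then that of a unit, so it is trivial; as `l'` is a local cube, `ζ^a` is one
  -- too.
  obtain ⟨k, j, hk⟩ : ∃ k j : ℕ, b + e * k = 3 * j := by
    rcases he with rfl | rfl
    · exact ⟨2 * b, b, by ring⟩
    · exact ⟨b, b, by ring⟩
  have hcl' : cls (l' : v.adicCompletion K) = 1 := cls_natCast_of_inert hl hl3 hv hcop
  have hnv : ¬ HasCubeValuation Valued.v (n : v.adicCompletion K) := by
    intro h
    have : HasCubeValuation Valued.v ((l : v.adicCompletion K) ^ e) :=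
      h.congr (by rw [hn', map_mul, map_pow _ (l' : v.adicCompletion K), hLl', one_pow, mul_one])
    have := this.pow_three_dvd hL0 hnl
    omega
  have hmem2 := mul_mem hloc (pow_mem (cls_natCast_mem_localClasses hξ) k)
  have hn0 := natCast_ne n (v.adicCompletion K)
  rw [← cls_pow hn0, ← cls_mul (by simp [*]) (pow_ne_zero k hn0)] at hmem2
  have e1 : Z ^ a * (l : v.adicCompletion K) ^ b * (l' : v.adicCompletion K) ^ c * (n : v.adicCompletion K) ^ k
      = Z ^ a * (l' : v.adicCompletion K) ^ (c + e * k) * ((l : v.adicCompletion K) ^ j) ^ 3 := by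
    rw [← pow_mul _ j, mul_comm j, ← hk, hn']
    ring
  rw [e1] at hmem2
  have h1 := cls_eq_one_of_mem h3 hnv (by simp [*])
    ((hasCubeValuation_mul_cube_iff (pow_ne_zero j hL0)).mpr (hasCubeValuation_of_eq_one (by
      rw [map_mul, map_pow, map_pow, hZ1, hLl']; simp))) hmem2
  rw [cls_mul (by simp [*]) (by simp [*]), cls_cube, mul_one,
    cls_mul (by simp [*]) (by simp [*]), cls_pow hL'0, hcl', one_pow, mul_one,
    cls_pow hZ0] at h1
  obtain ⟨y, hy⟩ := (cls_eq_one_iff hZ0).mp (CubeClass.eq_one_of_pow_eq_one ha h1)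
  exact not_cube_zeta hζ hl hl3 hl9 hv y (hy.trans hZ.symm)

/-- Independence of `ζ`, `l₁`, `l₂` modulo cubes. -/
lemma dvd_exponents_of_cls_eq_one {l₁ l₂ a b c : ℕ} (hζ : IsPrimitiveRoot ζ 3)
    (hl₁ : l₁.Prime) (hl₂ : l₂.Prime) (hne : l₁ ≠ l₂) (hl₁3 : l₁ ≡ 2 [MOD 3])
    (hl₂3 : l₂ ≡ 2 [MOD 3]) (h : cls ζ ^ a * cls (l₁ : K) ^ b * cls (l₂ : K) ^ c = 1) :
    3 ∣ a ∧ 3 ∣ b ∧ 3 ∣ c := by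
  have hζ0 : ζ ≠ 0 := hζ.ne_zero (by norm_num)
  have hl₁0 : (l₁ : K) ≠ 0 := by exact_mod_cast hl₁.ne_zero
  have hl₂0 : (l₂ : K) ≠ 0 := by exact_mod_cast hl₂.ne_zero
  have hu0 : ζ ^ a * (l₁ : K) ^ b * (l₂ : K) ^ c ≠ 0 := by simp [*]
  -- The valuation at `l` sees only the exponent of `l`; this is applied to both primes.
  have key : ∀ {l l' b c : ℕ}, l.Prime → l'.Prime → l ≠ l' → l ≡ 2 [MOD 3] →
      cls ζ ^ a * cls (l : K) ^ b * cls (l' : K) ^ c = 1 → 3 ∣ b := by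
    intro l l' b c hl hl' hne hl3 h
    have hl0 : (l : K) ≠ 0 := by exact_mod_cast hl.ne_zero
    have hl'0 : (l' : K) ≠ 0 := by exact_mod_cast hl'.ne_zero
    have hu0 : ζ ^ a * (l : K) ^ b * (l' : K) ^ c ≠ 0 := by simp [*]
    rw [← cls_pow hζ0, ← cls_pow hl0, ← cls_pow hl'0, ← cls_mul (by simp [*]) (by simp [*]),
      ← cls_mul (by simp [*]) (by simp [*]), cls_eq_one_iff hu0] at h
    obtain ⟨w, hw⟩ := h
    obtain ⟨v, hv⟩ := exists_inert_prime (K := K) hl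
    have hL0 : (l : v.adicCompletion K) ≠ 0 := by exact_mod_cast hl.ne_zero
    have hw0 : w ≠ 0 := by rintro rfl; exact hu0 (by rw [← hw]; ring)
    refine HasCubeValuation.pow_three_dvd hL0 (not_hasCubeValuation_of_inert hl hl3 hv)
      ((hasCubeValuation_cube (w := Valued.v)
        ((map_ne_zero (algebraMap K (v.adicCompletion K))).mpr hw0)).congr ?_)
    have h1 := valued_zeta (v := v) hζ
    have h2 : Valued.v (l' : v.adicCompletion K) = 1 := natCast_eq_one_iff.mpr
      (natCast_not_mem_of_coprime ((Nat.coprime_primes hl hl').mpr hne) hv)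
    rw [← map_pow (algebraMap K (v.adicCompletion K)), hw]
    simp only [map_mul, map_pow, map_natCast (algebraMap K (v.adicCompletion K)), h1, h2, one_pow,
      one_mul, mul_one]
  have hb := key hl₁ hl₂ hne hl₁3 h
  have hc := key hl₂ hl₁ hne.symm hl₂3 (by rwa [mul_right_comm])
  refine ⟨?_, hb, hc⟩
  by_contra ha
  obtain ⟨b, rfl⟩ := hb
  obtain ⟨c, rfl⟩ := hc
  rw [pow_mul, pow_mul, CubeClass.pow_three, CubeClass.pow_three, one_pow, one_pow, mul_one,
    mul_one] at h
  obtain ⟨y, hy⟩ := (cls_eq_one_iff hζ0).mp (CubeClass.eq_one_of_pow_eq_one ha h)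
  -- Any inert prime not `8` mod `9` shows that `ζ` is not a cube; `2` is one.
  obtain ⟨v, hv⟩ := exists_inert_prime (K := K) Nat.prime_two
  exact not_cube_zeta hζ Nat.prime_two (by decide) (by decide) hv (algebraMap K _ y)
    (by rw [← map_pow, hy])

/-- Elements of the Selmer group are generated by `ζ`, `l₁` and `l₂`. -/
lemma exists_eq_of_mem_selmer {l₁ l₂ n e : ℕ} [NeZero n] (hζ : IsPrimitiveRoot ζ 3)
    (hl₁ : l₁.Prime) (hl₂ : l₂.Prime) (hl₁3 : l₁ ≡ 2 [MOD 3]) (hl₂3 : l₂ ≡ 2 [MOD 3])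
    (hn : n = (l₁ * l₂) ^ e) {x : CubeClass K × CubeClass K} (hx : x ∈ selmer n hζ) :
    ∃ a b c : ℕ, x = pair (cls (ζ ^ a * (l₁ : K) ^ b * (l₂ : K) ^ c)) := by
  obtain ⟨u, hu, rfl⟩ := exists_of_mem_selmer hx
  rw [pair_mem_selmer_iff hu] at hx
  obtain ⟨a, b, c, w, rfl⟩ := exists_factorization hζ hl₁ hl₂ hl₁3 hl₂3 hu fun v h1 h2 => by
    rw [← hasCubeValuation_completion_iff]
    refine hasCubeValuation_of_mem ?_ ((map_ne_zero _).mpr hu) (hx v)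
    rw [hn]
    push_cast
    intro h
    rcases v.isPrime.mem_or_mem (v.isPrime.mem_of_pow_mem e h) with h | h
    · exact h1 h
    · exact h2 h
  refine ⟨a, b, c, ?_⟩
  rw [cls_mul (left_ne_zero_of_mul hu) (right_ne_zero_of_mul hu), cls_cube, mul_one]

/-- Local conditions for an element that is a unit away from `l₁l₂`. -/
lemma pair_mem_selmer {l₁ l₂ n e : ℕ} [NeZero n] (hζ : IsPrimitiveRoot ζ 3)
    (hn : n = (l₁ * l₂) ^ e) {u : K} (hu : u ≠ 0)
    (hunit : ∀ v : HeightOneSpectrum (𝓞 K), (l₁ : 𝓞 K) ∉ v.asIdeal → (l₂ : 𝓞 K) ∉ v.asIdeal →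
      v.valuation K u = 1)
    (h3 : ∀ v : HeightOneSpectrum (𝓞 K), (3 : 𝓞 K) ∈ v.asIdeal →
      cls (algebraMap K (v.adicCompletion K) u) ∈
        localClasses n (hζ.map_of_injective (algebraMap K (v.adicCompletion K)).injective))
    (h1 : ∀ v : HeightOneSpectrum (𝓞 K), (l₁ : 𝓞 K) ∈ v.asIdeal →
      cls (algebraMap K (v.adicCompletion K) u) ∈
        localClasses n (hζ.map_of_injective (algebraMap K (v.adicCompletion K)).injective))
    (h2 : ∀ v : HeightOneSpectrum (𝓞 K), (l₂ : 𝓞 K) ∈ v.asIdeal →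
      cls (algebraMap K (v.adicCompletion K) u) ∈
        localClasses n (hζ.map_of_injective (algebraMap K (v.adicCompletion K)).injective)) :
    pair (cls u) ∈ selmer n hζ := by
  rw [pair_mem_selmer_iff hu]
  intro v
  by_cases hv1 : (l₁ : 𝓞 K) ∈ v.asIdeal
  · exact h1 v hv1
  by_cases hv2 : (l₂ : 𝓞 K) ∈ v.asIdeal
  · exact h2 v hv2
  by_cases hv3 : (3 : 𝓞 K) ∈ v.asIdeal
  · exact h3 v hv3
  refine pair_mem_kummerImage_of_unit _ hv3 ?_ (by rw [valued_coe_eq]; exact hunit v hv1 hv2)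
  rw [hn]
  push_cast
  intro h
  rcases v.isPrime.mem_or_mem (v.isPrime.mem_of_pow_mem e h) with h | h
  · exact hv1 h
  · exact hv2 h

/-- The class of `l₁` satisfies all local conditions if it does so above `3`. -/
lemma cls_prime_mem_selmer {l₁ l₂ n e : ℕ} [NeZero n] (hζ : IsPrimitiveRoot ζ 3)
    (hl₁ : l₁.Prime) (hl₂ : l₂.Prime) (hne : l₁ ≠ l₂) (hl₁3 : l₁ ≡ 2 [MOD 3])
    (hl₂3 : l₂ ≡ 2 [MOD 3]) (he : e = 1 ∨ e = 2) (hn : n = (l₁ * l₂) ^ e)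
    (h : ∃ k, (l₁ * n ^ k) % 9 = 1 ∨ (l₁ * n ^ k) % 9 = 8) :
    pair (cls (l₁ : K)) ∈ selmer n hζ := by
  have hl₁0 : (l₁ : K) ≠ 0 := by exact_mod_cast hl₁.ne_zero
  have hcop : l₁.Coprime l₂ := (Nat.coprime_primes hl₁ hl₂).mpr hne
  have hcop' : l₂.Coprime l₁ := hcop.symm
  refine pair_mem_selmer hζ hn hl₁0 (fun v h1 _ => ?_) (fun v hv => ?_) (fun v hv => ?_)
    (fun v hv => ?_)
  · have := (v.valuation_eq_one_iff_notMem (K := K)).mpr h1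
    rwa [map_natCast] at this
  -- Above `3`, the product `l₁n^k` is a cube, so `l₁` has the class of `n^(-k)`.
  · obtain ⟨k, hk⟩ := h
    have h1 := cls_natCast_eq_one hv hk
    have hn0 := natCast_ne n (v.adicCompletion K)
    have hL0 : (l₁ : v.adicCompletion K) ≠ 0 := by exact_mod_cast hl₁.ne_zero
    push_cast at h1
    rw [cls_mul hL0 (pow_ne_zero k hn0), cls_pow hn0] at h1
    rw [map_natCast, eq_inv_of_mul_eq_one_left h1]
    exact inv_mem (pow_mem (cls_natCast_mem_localClasses _) k)
  · have hmem := cls_natCast_mem_localClasses (n := n)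
      (hζ.map_of_injective (algebraMap K (v.adicCompletion K)).injective)
    have hL0 : (l₁ : v.adicCompletion K) ≠ 0 := by exact_mod_cast hl₁.ne_zero
    have hL'0 : (l₂ : v.adicCompletion K) ≠ 0 := by exact_mod_cast hl₂.ne_zero
    -- At `l₁` the other prime is a cube, so `n` has the class of `l₁^e`, and `e` is prime to `3`.
    have hcn : cls (n : v.adicCompletion K) = cls (l₁ : v.adicCompletion K) ^ e := by
      rw [hn]; push_cast
      rw [cls_pow (mul_ne_zero hL0 hL'0), cls_mul hL0 hL'0, cls_natCast_of_inert hl₁ hl₁3 hv hcop,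
        mul_one]
    rw [hcn] at hmem
    rw [map_natCast]
    exact CubeClass.mem_of_pow_mem (by omega) hmem
  · rw [map_natCast, cls_natCast_of_inert hl₂ hl₂3 hv hcop']
    exact one_mem _

/-- The class of `ζ` lies in the Selmer group when `l₁ ≡ l₂ ≡ 8 mod 9`. -/
lemma cls_zeta_mem_selmer {l₁ l₂ n e : ℕ} [NeZero n] (hζ : IsPrimitiveRoot ζ 3)
    (hl₁ : l₁.Prime) (hl₂ : l₂.Prime) (hl₁9 : l₁ ≡ 8 [MOD 9]) (hl₂9 : l₂ ≡ 8 [MOD 9])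
    (hn : n = (l₁ * l₂) ^ e) : pair (cls ζ) ∈ selmer n hζ := by
  have hζ0 : ζ ≠ 0 := hζ.ne_zero (by norm_num)
  have hone : ∀ {l : ℕ} (v : HeightOneSpectrum (𝓞 K)), l.Prime → l ≡ 8 [MOD 9] →
      (l : 𝓞 K) ∈ v.asIdeal → cls (algebraMap K (v.adicCompletion K) ζ) ∈
        localClasses n (hζ.map_of_injective (algebraMap K (v.adicCompletion K)).injective) := by
    intro l v hl hl9 hv
    obtain ⟨y, hy⟩ := exists_cube_root_zeta hζ hl hl9 hv
    rw [(cls_eq_one_iff ((map_ne_zero _).mpr hζ0)).mpr ⟨y, hy⟩]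
    exact one_mem _
  refine pair_mem_selmer hζ hn hζ0 (fun v _ _ => ?_) (fun v hv => ?_)
    (fun v hv => hone v hl₁ hl₁9 hv) (fun v hv => hone v hl₂ hl₂9 hv)
  · rw [← valued_coe_eq]
    exact valued_zeta hζ
  · have hn9 : n % 9 = 1 := by
      have : n ≡ (8 * 8) ^ e [MOD 9] := hn ▸ (hl₁9.mul hl₂9).pow e
      have h1 : (8 * 8) ^ e ≡ 1 ^ e [MOD 9] := Nat.ModEq.pow e (by decide)
      have := this.trans h1
      rwa [one_pow] at this
    obtain ⟨w, hw⟩ := exists_cube_root_intCast hv (m := n) (by omega)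
    have hw0 : w ≠ 0 := by
      rintro rfl
      exact natCast_ne n (v.adicCompletion K) (by simpa using hw.symm)
    rw [Int.cast_natCast] at hw
    rw [mem_localClasses, pair_mem_kummerImage_iff _ ((map_ne_zero _).mpr hζ0)]
    -- With `n = w³` the equation becomes `ζ + ζ² + 1 = 0`.
    refine ⟨1, 1, w⁻¹, by simp, ?_⟩
    have hsum := congrArg (algebraMap K (v.adicCompletion K)) (hζ.geom_sum_eq_zero (by norm_num))
    simp only [Finset.sum_range_succ, Finset.sum_range_zero, map_add, map_pow, map_zero,
      pow_zero, map_one, pow_one] at hsum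
    rw [← hw]
    field_simp
    linear_combination hsum

end Selmer

/-! ### The three dimension counts -/

section Dimension

variable {K : Type*} [Field K] [NumberField K] [IsCyclotomicExtension {3} ℚ K] {ζ : K}

lemma cls_zeta_mul {l₁ l₂ a b c : ℕ} (hζ : IsPrimitiveRoot ζ 3) (hl₁ : l₁.Prime) (hl₂ : l₂.Prime) :
    cls (ζ ^ a * (l₁ : K) ^ b * (l₂ : K) ^ c) = cls ζ ^ a * cls (l₁ : K) ^ b * cls (l₂ : K) ^ c := by
  have hζ0 : ζ ≠ 0 := hζ.ne_zero (by norm_num)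
  have hl₁0 : (l₁ : K) ≠ 0 := by exact_mod_cast hl₁.ne_zero
  have hl₂0 : (l₂ : K) ≠ 0 := by exact_mod_cast hl₂.ne_zero
  rw [cls_mul (by simp [*]) (by simp [*]), cls_mul (by simp [*]) (by simp [*]), cls_pow hζ0,
    cls_pow hl₁0, cls_pow hl₂0]

lemma cls_n_eq {F : Type*} [Field F] [CharZero F] {l₁ l₂ n e : ℕ} (hl₁ : l₁.Prime) (hl₂ : l₂.Prime)
    (hn : n = (l₁ * l₂) ^ e) : cls (n : F) = cls (l₁ : F) ^ e * cls (l₂ : F) ^ e := by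
  have hl₁0 : (l₁ : F) ≠ 0 := by exact_mod_cast hl₁.ne_zero
  have hl₂0 : (l₂ : F) ≠ 0 := by exact_mod_cast hl₂.ne_zero
  rw [hn]
  push_cast
  rw [cls_pow (mul_ne_zero hl₁0 hl₂0), cls_mul hl₁0 hl₂0, mul_pow]

/-- If one of `l₁`, `l₂` is not `8` modulo `9`, the Selmer group is generated by `l₁` and `l₂`. -/
lemma exists_eq_of_mem_selmer_of_not {l₁ l₂ n e : ℕ} [NeZero n] (hζ : IsPrimitiveRoot ζ 3)
    (hl₁ : l₁.Prime) (hl₂ : l₂.Prime) (hne : l₁ ≠ l₂) (hl₁3 : l₁ ≡ 2 [MOD 3])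
    (hl₂3 : l₂ ≡ 2 [MOD 3]) (he : e = 1 ∨ e = 2) (hn : n = (l₁ * l₂) ^ e)
    (h8 : ¬ (l₁ ≡ 8 [MOD 9] ∧ l₂ ≡ 8 [MOD 9])) {x : CubeClass K × CubeClass K}
    (hx : x ∈ selmer n hζ) : ∃ b c : ℕ, x = pair (cls (l₁ : K) ^ b * cls (l₂ : K) ^ c) := by
  obtain ⟨a, b, c, rfl⟩ := exists_eq_of_mem_selmer hζ hl₁ hl₂ hl₁3 hl₂3 hn hx
  have ha : 3 ∣ a := by
    by_cases h : l₁ ≡ 8 [MOD 9]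
    · refine dvd_exponent_of_mem (n := n) (b := c) (c := b) hζ hl₂ hl₁ hne.symm hl₂3 (fun h' => h8 ⟨h, h'⟩) he
        (by rw [hn, mul_comm]) ?_
      rwa [mul_right_comm]
    · exact dvd_exponent_of_mem hζ hl₁ hl₂ hne hl₁3 h he hn hx
  obtain ⟨a, rfl⟩ := ha
  exact ⟨b, c, by rw [cls_zeta_mul hζ hl₁ hl₂, pow_mul, CubeClass.pow_three, one_pow, one_mul]⟩

/-- Here `n ≡ 1 mod 9` is locally trivial above `3`, and the obstruction to `2` there forces `b ≡ c
mod 3`. Only powers of `l₁l₂`, equivalently of `n`, remain. -/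
theorem finrank_selmer_of_two_five {l₁ l₂ n e : ℕ} [NeZero n] (hζ : IsPrimitiveRoot ζ 3)
    (hl₁ : l₁.Prime) (hl₂ : l₂.Prime) (he : e = 1 ∨ e = 2) (hn : n = (l₁ * l₂) ^ e)
    (h₁ : l₁ ≡ 2 [MOD 9]) (h₂ : l₂ ≡ 5 [MOD 9]) :
    Module.finrank (ZMod 3) (Additive (selmer n hζ)) = 1 := by
  have hne : l₁ ≠ l₂ := by
    rintro rfl
    exact absurd (h₁.symm.trans h₂) (by decide)
  have hl₁3 : l₁ ≡ 2 [MOD 3] := h₁.of_dvd (by norm_num)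
  have hl₂3 : l₂ ≡ 2 [MOD 3] := by
    unfold Nat.ModEq at *
    omega
  have h10 : (l₁ * l₂) % 9 = 1 := h₁.mul h₂
  have hn9 : n % 9 = 1 := by
    have : (l₁ * l₂) ^ e ≡ 1 ^ e [MOD 9] := Nat.ModEq.pow e h10
    rw [one_pow] at this
    rw [hn]
    exact this
  refine finrank_eq_of_basis ![cls (n : K)] (fun i => ?_) (fun x hx => ?_) (fun f hf => ?_)
  · fin_cases i
    exact cls_natCast_mem_selmer hζ
  · obtain ⟨b, c, rfl⟩ := exists_eq_of_mem_selmer_of_not hζ hl₁ hl₂ hne hl₁3 hl₂3 he hn (by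
      rintro ⟨h, -⟩
      exact absurd (h₁.symm.trans h) (by decide)) hx
    have hbc : b % 3 = c % 3 := by
      by_contra hbc
      obtain ⟨v, hv⟩ := exists_prime_over_three K
      have hl₁0 : (l₁ : K) ≠ 0 := by exact_mod_cast hl₁.ne_zero
      have hl₂0 : (l₂ : K) ≠ 0 := by exact_mod_cast hl₂.ne_zero
      have hL₁0 : (l₁ : v.adicCompletion K) ≠ 0 := by exact_mod_cast hl₁.ne_zero
      have hL₂0 : (l₂ : v.adicCompletion K) ≠ 0 := by exact_mod_cast hl₂.ne_zero
      rw [← cls_pow hl₁0, ← cls_pow hl₂0, ← cls_mul (by simp [*]) (by simp [*]),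
        pair_mem_selmer_iff (by simp [*])] at hx
      have hloc := hx v
      rw [map_mul, map_pow, map_pow, map_natCast, map_natCast, cls_mul (by simp [*]) (by simp [*]),
        cls_pow hL₁0, cls_pow hL₂0] at hloc
      -- Modulo `9`, `4l₁ ≡ 8` and `2l₂ ≡ 1`; hence above `3` the classes of `l₁` and `l₂` are those
      -- of `2` and `2²`.
      have e1 : cls (l₁ : v.adicCompletion K) * cls (2 : v.adicCompletion K) ^ 2 = 1 := by
        have := cls_natCast_eq_one hv (m := l₁ * 2 ^ 2) (.inr (by
          unfold Nat.ModEq at h₁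
          omega))
        rwa [Nat.cast_mul, Nat.cast_pow, Nat.cast_ofNat, cls_mul hL₁0 (by norm_num),
          cls_pow two_ne_zero] at this
      have e2 : cls (l₂ : v.adicCompletion K) * cls (2 : v.adicCompletion K) = 1 := by
        have := cls_natCast_eq_one hv (m := l₂ * 2) (.inl (h₂.mul_right 2))
        push_cast at this
        rwa [cls_mul hL₂0 two_ne_zero] at this
      have e3 := CubeClass.pow_three (cls (2 : v.adicCompletion K))
      have e1' : cls (l₁ : v.adicCompletion K) = cls (2 : v.adicCompletion K) := by
        rw [eq_inv_of_mul_eq_one_left e1]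
        exact inv_eq_of_mul_eq_one_left (by rw [← pow_succ', e3])
      have e2' : cls (l₂ : v.adicCompletion K) = cls (2 : v.adicCompletion K) ^ 2 := by
        rw [eq_inv_of_mul_eq_one_left e2]
        exact inv_eq_of_mul_eq_one_left (by rw [← pow_succ, e3])
      rw [e1', e2', ← pow_mul, ← pow_add] at hloc
      exact two_not_mem_kummerImage hζ hv hn9 _ (CubeClass.mem_of_pow_mem (by omega) hloc)
    rcases he with rfl | rfl
    · refine ⟨fun _ => b, ?_⟩
      simp only [Finset.univ_unique, Finset.prod_singleton, Matrix.cons_val_fin_one]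
      rw [cls_n_eq hl₁ hl₂ hn, pow_one, pow_one, mul_pow, ← pow_mod_three _ c, ← hbc, pow_mod_three]
    -- For `e = 2`, `n^(2b) = (l₁l₂)^(4b)`, which has the class of `(l₁l₂)^b`.
    · refine ⟨fun _ => 2 * b, ?_⟩
      simp only [Finset.univ_unique, Finset.prod_singleton, Matrix.cons_val_fin_one]
      rw [cls_n_eq hl₁ hl₂ hn, mul_pow, ← pow_mul, ← pow_mul, ← pow_mod_three _ c, ← hbc,
        ← pow_mod_three (cls (l₁ : K)) (2 * (2 * b)), ← pow_mod_three (cls (l₂ : K)) (2 * (2 * b)),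
        show 2 * (2 * b) % 3 = b % 3 by omega, pow_mod_three, pow_mod_three]
  · intro i
    simp only [Finset.univ_unique, Finset.prod_singleton, Matrix.cons_val_fin_one] at hf
    rw [cls_n_eq hl₁ hl₂ hn, mul_pow, ← pow_mul, ← pow_mul] at hf
    have := (dvd_exponents_of_cls_eq_one (a := 0) hζ hl₁ hl₂ hne hl₁3 hl₂3
      (by rwa [pow_zero, one_mul])).2.1
    have hi : i = default := Subsingleton.elim _ _
    rw [hi]
    rcases he with rfl | rfl <;> omega

/-- All of `ζ`, `l₁`, `l₂` meet every local condition, so the upper bound from the factorization is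
attained. -/
theorem finrank_selmer_of_eight_eight {l₁ l₂ n e : ℕ} [NeZero n] (hζ : IsPrimitiveRoot ζ 3)
    (hl₁ : l₁.Prime) (hl₂ : l₂.Prime) (hne : l₁ ≠ l₂) (he : e = 1 ∨ e = 2)
    (hn : n = (l₁ * l₂) ^ e) (h₁ : l₁ ≡ 8 [MOD 9]) (h₂ : l₂ ≡ 8 [MOD 9]) :
    Module.finrank (ZMod 3) (Additive (selmer n hζ)) = 3 := by
  have hl₁3 : l₁ ≡ 2 [MOD 3] := by
    unfold Nat.ModEq at *
    omega
  have hl₂3 : l₂ ≡ 2 [MOD 3] := by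
    unfold Nat.ModEq at *
    omega
  refine finrank_eq_of_basis ![cls ζ, cls (l₁ : K), cls (l₂ : K)] (fun i => ?_) (fun x hx => ?_)
    (fun f hf => ?_)
  · fin_cases i
    · exact cls_zeta_mem_selmer hζ hl₁ hl₂ h₁ h₂ hn
    · exact cls_prime_mem_selmer hζ hl₁ hl₂ hne hl₁3 hl₂3 he hn ⟨0, .inr (by simpa [Nat.ModEq] using h₁)⟩
    · exact cls_prime_mem_selmer hζ hl₂ hl₁ hne.symm hl₂3 hl₁3 he (by rw [hn, mul_comm])
        ⟨0, .inr (by simpa [Nat.ModEq] using h₂)⟩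
  · obtain ⟨a, b, c, rfl⟩ := exists_eq_of_mem_selmer hζ hl₁ hl₂ hl₁3 hl₂3 hn hx
    exact ⟨![a, b, c], by rw [cls_zeta_mul hζ hl₁ hl₂, Fin.prod_univ_three]; rfl⟩
  · rw [Fin.prod_univ_three] at hf
    obtain ⟨h0, h1, h2⟩ := dvd_exponents_of_cls_eq_one hζ hl₁ hl₂ hne hl₁3 hl₂3 hf
    intro i
    fin_cases i
    · exact h0
    · exact h1
    · exact h2

theorem finrank_selmer_of_four_or_seven {l₁ l₂ n e : ℕ} [NeZero n] (hζ : IsPrimitiveRoot ζ 3)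
    (hl₁ : l₁.Prime) (hl₂ : l₂.Prime) (hne : l₁ ≠ l₂) (hl₁3 : l₁ ≡ 2 [MOD 3])
    (hl₂3 : l₂ ≡ 2 [MOD 3]) (he : e = 1 ∨ e = 2) (hn : n = (l₁ * l₂) ^ e)
    (h : n ≡ 4 [MOD 9] ∨ n ≡ 7 [MOD 9]) :
    Module.finrank (ZMod 3) (Additive (selmer n hζ)) = 2 := by
  -- The residue of `n` generates `(ℤ/9)ˣ/±1`, which has order `3`, so some power of `n` carries `l`
  -- to `-1`.
  have hk : ∀ {l : ℕ}, l ≡ 2 [MOD 3] → ∃ k, (l * n ^ k) % 9 = 1 ∨ (l * n ^ k) % 9 = 8 := by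
    intro l hl
    have h' : l % 9 = 2 ∨ l % 9 = 5 ∨ l % 9 = 8 := by
      unfold Nat.ModEq at hl
      omega
    have key : ∀ {r s k : ℕ}, l ≡ r [MOD 9] → n ≡ s [MOD 9] → (r * s ^ k) % 9 = 8 →
        ∃ k, (l * n ^ k) % 9 = 1 ∨ (l * n ^ k) % 9 = 8 := fun {r s k} hr hs hrs =>
      ⟨k, .inr (Eq.trans (hr.mul (hs.pow k)) hrs)⟩
    rcases h' with h' | h' | h' <;> rcases h with h | h
    · exact key (r := 2) (k := 1) h' h (by norm_num)
    · exact key (r := 2) (k := 2) h' h (by norm_num)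
    · exact key (r := 5) (k := 2) h' h (by norm_num)
    · exact key (r := 5) (k := 1) h' h (by norm_num)
    · exact key (r := 8) (k := 0) h' h (by norm_num)
    · exact key (r := 8) (k := 0) h' h (by norm_num)
  have h8 : ¬ (l₁ ≡ 8 [MOD 9] ∧ l₂ ≡ 8 [MOD 9]) := by
    rintro ⟨h₁, h₂⟩
    have h1 : (l₁ * l₂) ^ e ≡ 1 ^ e [MOD 9] :=
      Nat.ModEq.pow e ((h₁.mul h₂).trans (by decide))
    rw [← hn, one_pow] at h1
    rcases h with h | h
    · exact absurd (h.symm.trans h1) (by decide)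
    · exact absurd (h.symm.trans h1) (by decide)
  refine finrank_eq_of_basis ![cls (l₁ : K), cls (l₂ : K)] (fun i => ?_) (fun x hx => ?_)
    (fun f hf => ?_)
  · fin_cases i
    · exact cls_prime_mem_selmer hζ hl₁ hl₂ hne hl₁3 hl₂3 he hn (hk hl₁3)
    · exact cls_prime_mem_selmer hζ hl₂ hl₁ hne.symm hl₂3 hl₁3 he (by rw [hn, mul_comm]) (hk hl₂3)
  · obtain ⟨b, c, rfl⟩ := exists_eq_of_mem_selmer_of_not hζ hl₁ hl₂ hne hl₁3 hl₂3 he hn h8 hx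
    exact ⟨![b, c], by rw [Fin.prod_univ_two]; rfl⟩
  · rw [Fin.prod_univ_two] at hf
    obtain ⟨-, h1, h2⟩ := dvd_exponents_of_cls_eq_one (a := 0) hζ hl₁ hl₂ hne hl₁3 hl₂3
      (by rw [pow_zero, one_mul]; exact hf)
    intro i
    fin_cases i
    · exact h1
    · exact h2

end Dimension

end CubeSum

theorem proposition2p1 {K : Type*} [Field K] [NumberField K] [IsCyclotomicExtension {3} ℚ K]
    {ζ : K} (hζ : IsPrimitiveRoot ζ 3) (l₁ l₂ n : ℕ) [NeZero n]
    (hl₁ : l₁.Prime) (hl₂ : l₂.Prime) (hne : l₁ ≠ l₂)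
    (hl₁3 : l₁ ≡ 2 [MOD 3]) (hl₂3 : l₂ ≡ 2 [MOD 3])
    (hn : n = l₁ * l₂ ∨ n = l₁ ^ 2 * l₂ ^ 2) :
    (l₁ ≡ 2 [MOD 9] → l₂ ≡ 5 [MOD 9] →
      Module.finrank (ZMod 3) (Additive (CubeSum.selmer n hζ)) = 1) ∧
    (l₁ ≡ 8 [MOD 9] → l₂ ≡ 8 [MOD 9] →
      Module.finrank (ZMod 3) (Additive (CubeSum.selmer n hζ)) = 3) ∧
    (n ≡ 4 [MOD 9] ∨ n ≡ 7 [MOD 9] →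
      Module.finrank (ZMod 3) (Additive (CubeSum.selmer n hζ)) = 2) := by
  obtain ⟨e, he, hn⟩ : ∃ e, (e = 1 ∨ e = 2) ∧ n = (l₁ * l₂) ^ e := by
    rcases hn with rfl | rfl
    · exact ⟨1, .inl rfl, (pow_one _).symm⟩
    · exact ⟨2, .inr rfl, (mul_pow _ _ _).symm⟩
  exact ⟨CubeSum.finrank_selmer_of_two_five hζ hl₁ hl₂ he hn,
    CubeSum.finrank_selmer_of_eight_eight hζ hl₁ hl₂ hne he hn,
    CubeSum.finrank_selmer_of_four_or_seven hζ hl₁ hl₂ hne hl₁3 hl₂3 he hn⟩
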